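/- **Setting.** Fix $d$, a decay parameter $\alpha>0$ and finitely many realizations $h\in\mathcal H$ of a $d$-dimensional point process; $h$ has events $(t^h_i,u^h_i)$, $1\le i\le n_h$, with types $u_i^h\in\{1,\dots,d\}$ and times in the observation period $[T_h^-,T_h^+]$. For $j\ge1$ put $$B^h_{0,j}(s)=e^{-j\alpha s},\qquad B^h_{v,j}(s)=\sum_{i:\,t^h_i<s,\ u^h_i=v}e^{-(j+1)\alpha(s-t^h_i)}\quad(1\le v\le d).$$ For coefficients $X=(X_{uv,j})_{1\le u\le d,\,0\le v\le d,\,1\le j\le k}\in\mathbb R^{d(d+1)k}$ the $k$-th relaxed log-likelihood is $$\hat L^k(X)=\sum_{h}\sum_{i=1}^{n_h}\ln\bigl(A^{k,h,i}X\bigr)-\hat B^kX,$$ where $A^{k,h,i}X=\sum_{v,j}X_{u^h_i v,j}\,B^h_{v,j}(t^h_i)$ and $\hat B^kX=\sum_{u,v,j}X_{uv,j}\sum_h\int_{T_h^-}^{T_h^+}B^h_{v,j}(s)\,ds$; its domain is $\mathcal D^k=\{X: A^{k,h,i}X>0\text{ for all }h,i\}$, and $\hat L^k=-\infty$ elsewhere.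 **Newton's method.** Fix line search parameters $a\in(0,1/2)$, $b\in(0,1)$. To minimize $f$ with domain $D$ ($f=+\infty$ outside $D$), an iteration at $x$ takes a Newton direction $v$, i.e. a solution of $\nabla^2f(x)v=-\nabla f(x)$ (any one, if the Hessian is singular), and moves to $x+tv$, where $t$ is the first of $1,b,b^2,\dots$ with $x+tv\in D$ and $f(x+tv)\le f(x)+a\,t\,\nabla f(x)^{T}v$. With tolerance $\varepsilon$ the method stops at the first iterate whose Newton decrement $\lambda=(v^T\nabla^2f(x)v)^{1/2}$ satisfies $\lambda^2\le\varepsilon$ and $\lambda\le1/2$. A function is self-concordant on an open convex set $D$ if it is convex and $C^3$ there and $|D^3f(x)[v,v,v]|\le2(D^2f(x)[v,v])^{3/2}$ for all $x\in D$ and all $v$. **MEMIP** with $K\ge1$ stages, started at $W^1\in\mathbb R^{d(d+1)}$: $X^1$ is the output of Newton's method for the maximization of $\hat L^1$ (that is, the minimization of $-\hat L^1$) started at $W^1$; for $2\le k\le K$, $X^k$ is the output of Newton's method for the maximization of $\hat L^k$ started at the warm start $W^k$, given by $W^k_{uv,j}=X^{k-1}_{uv,j}$ for $j\le k-1$ and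 $W^k_{uv,k}=0$. **Statement.** There is a constant $C>0$ that depends only on the line search parameters $a,b$ such that the following hold for every $0<\varepsilon\le1/2$. 1. (Lemma.) Let $f$ be self-concordant on an open convex set $D\subseteq\mathbb R^N$ and bounded below, and let $x_0\in D$ be such that the sublevel set $\{x\in D: f(x)\le f(x_0)\}$ is closed in $\mathbb R^N$. Then Newton's method started at $x_0$ never gets stuck and stays in $D$, it stops after at most $$C\bigl(f(x_0)-\inf_D f\bigr)+\log_2\log_2(1/\varepsilon)$$ iterations, and its output $x$ satisfies $f(x)-\inf_D f\le\varepsilon$. 2. (Proposition.) For all $d$, $\mathcal H$, $\alpha>0$ and $K\ge1$ such that $\sup\hat L^K<\infty$ and all $W^1\in\mathcal D^1$: MEMIP has an execution started at $W^1$ that runs to completion, and every such execution produces $X^1,\dots,X^K$ with $X^k\in\mathcal D^k$, $\sup\hat L^k<\infty$ and $$\bigl|\hat L^k(X^k)-\sup_X\hat L^k(X)\bigr|\le\varepsilon\qquad(1\le k\le K),$$ and its total number of Newton iterations is at most $$C\Bigl(\sup_X\hat L^K(X)-\hat L^1(W^1)\Bigr)+K\bigl(\log_2\log_2(1/\varepsilon)+C\varepsilon\bigr).$$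 -/

import Mathlib

open scoped BigOperators

noncomputable section

/-! ## Self-concordant functions and Newton's method with backtracking line search -/

section Newton

variable {E : Type*} [NormedAddCommGroup E] [NormedSpace ℝ E]

/-- `f` is a (standard) self-concordant function on the open convex set `D`: it is convex, three
times continuously differentiable, and `|D³f(x)[v,v,v]| ≤ 2 (D²f(x)[v,v])^(3/2)`. -/
structure SelfConcordantOn (D : Set E) (f : E → ℝ) : Prop where
  isOpen : IsOpen D
  convexOn : ConvexOn ℝ D f
  contDiffOn : ContDiffOn ℝ 3 f D
  third_le : ∀ x ∈ D, ∀ v : E,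
    |iteratedFDeriv ℝ 3 f x ![v, v, v]| ≤ 2 * (iteratedFDeriv ℝ 2 f x ![v, v]) ^ (3 / 2 : ℝ)

/-- `v` is a Newton direction for the minimization of `f` at `x`: it solves the Newton equation
`∇²f(x) v = -∇f(x)` (so `v = -∇²f(x)⁻¹ ∇f(x)` whenever the Hessian is invertible). -/
def IsNewtonDirection (f : E → ℝ) (x v : E) : Prop :=
  ∀ w : E, iteratedFDeriv ℝ 2 f x ![v, w] = -(fderiv ℝ f x w)

/-- Stopping test. The squared Newton decrement `λ(x)² = D²f(x)[v,v]`, `v` a Newton direction (its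
value does not depend on which one), satisfies `λ(x)² ≤ ε`; the test also asks for `λ(x) ≤ 1/2`. -/
def NewtonStops (f : E → ℝ) (ε : ℝ) (x : E) : Prop :=
  ∃ v : E, IsNewtonDirection f x v ∧
    iteratedFDeriv ℝ 2 f x ![v, v] ≤ ε ∧ iteratedFDeriv ℝ 2 f x ![v, v] ≤ 1 / 4

/-- Sufficient-decrease condition with parameter `a` for the step size `t` in direction `v`; `f` is
regarded as `+∞` outside its domain `D`. -/
def SufficientDecrease (a : ℝ) (D : Set E) (f : E → ℝ) (x v : E) (t : ℝ) : Prop :=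
  x + t • v ∈ D ∧ f (x + t • v) ≤ f x + a * t * fderiv ℝ f x v

/-- One Newton iteration from `x` to `y`: among the step sizes `1, b, b², …` the first one that
gives sufficient decrease in a Newton direction is taken. -/
def NewtonStep (a b : ℝ) (D : Set E) (f : E → ℝ) (x y : E) : Prop :=
  ∃ v : E, IsNewtonDirection f x v ∧ ∃ m : ℕ,
    SufficientDecrease a D f x v (b ^ m) ∧
    (∀ j < m, ¬ SufficientDecrease a D f x v (b ^ j)) ∧
    y = x + b ^ m • v

/-- Newton's method with tolerance `ε`, started at `x₀`, performs (at least) `n` iterations and `y`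
is its `n`-th iterate. An iteration is performed only where the stopping test fails. -/
inductive NewtonReaches (a b ε : ℝ) (D : Set E) (f : E → ℝ) (x₀ : E) : ℕ → E → Prop
  | start : NewtonReaches a b ε D f x₀ 0 x₀
  | step {n : ℕ} {y z : E} : NewtonReaches a b ε D f x₀ n y → ¬ NewtonStops f ε y →
      NewtonStep a b D f y z → NewtonReaches a b ε D f x₀ (n + 1) z

/-- Newton maximization of `F` (with value `-∞` outside `D`), started at `x₀`, stops after exactly
`n` iterations and returns `x`. -/
def IsNewtonArgMax (a b ε : ℝ) (D : Set E) (F : E → ℝ) (x₀ : E) (n : ℕ) (x : E) : Prop :=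
  NewtonReaches a b ε D (fun y => -F y) x₀ n x ∧ NewtonStops (fun y => -F y) ε x

end Newton

/-! ## The relaxed log-likelihood of a multivariate Hawkes process -/

/-- A realization of a `d`-dimensional point process: an observation period `[tStart, tStop]` and
`n` events in this period, the `i`-th one at time `time i` and of type `mark i`. -/
structure HawkesRealization (d : ℕ) where
  tStart : ℝ
  tStop : ℝ
  tStart_le_tStop : tStart ≤ tStop
  n : ℕ
  time : Fin n → ℝ
  mark : Fin n → Fin d
  time_mem : ∀ i, time i ∈ Set.Icc tStart tStop

/-- Coefficients `X_{uv,j}`: `u` is the type whose rate is described, `v = 0` stands for its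
background rate and `v = v'.succ` for the influence on it of events of type `v'`; the entry
`j : Fin k` stands for the basis function of order `j + 1`. The dimension is `d (d + 1) k`. -/
abbrev HawkesParam (d k : ℕ) : Type := Fin d → Fin (d + 1) → Fin k → ℝ

/-- The Euclidean pairing of coefficient vectors. -/
def hawkesDot {d k : ℕ} (c X : HawkesParam d k) : ℝ :=
  ∑ u, ∑ v, ∑ j, c u v j * X u v j

/-- The value at time `s` of the order `p` exponential feature: `exp (-p α s)` for the background,
and `∑ exp (-(p+1) α (s - tᵢ))` over the events of type `v'` that occur before `s`. -/
def hawkesFeature {d : ℕ} (α : ℝ) (h : HawkesRealization d) (p : ℕ) (s : ℝ) : Fin (d + 1) → ℝ :=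
  Fin.cases (Real.exp (-(p * α * s)))
    (fun v' => ∑ i : Fin h.n,
      if h.time i < s ∧ h.mark i = v' then Real.exp (-((p + 1) * α * (s - h.time i))) else 0)

/-- The vector `A^{k,h,i}`, for which `A^{k,h,i} X` is the rate, at the time of the `i`-th event of
`h`, of the type of this event. -/
def hawkesA {d : ℕ} (α : ℝ) (h : HawkesRealization d) (i : Fin h.n) (k : ℕ) : HawkesParam d k :=
  fun u v j => if h.mark i = u then hawkesFeature α h (j + 1) (h.time i) v else 0

/-- The vector `B̂^k`, for which `B̂^k X` is the sum over the realizations and over the types of the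
integral, over the observation period, of the rate (without positive part). -/
def hawkesB {d m : ℕ} (α : ℝ) (H : Fin m → HawkesRealization d) (k : ℕ) : HawkesParam d k :=
  fun _ v j => ∑ r, ∫ s in (H r).tStart..(H r).tStop, hawkesFeature α (H r) (j + 1) s v

/-- The set on which the relaxed log-likelihood is finite: the predicted rate of every observed
event is positive. -/
def relaxedDomain {d m : ℕ} (α : ℝ) (H : Fin m → HawkesRealization d) (k : ℕ) :
    Set (HawkesParam d k) :=
  {X | ∀ (r : Fin m) (i : Fin (H r).n), 0 < hawkesDot (hawkesA α (H r) i k) X}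

/-- The relaxed log-likelihood `L̂^k(X) = ∑_h ∑_i ln (A^{k,h,i} X) - B̂^k X` on its domain. -/
def relaxedLogLik {d m : ℕ} (α : ℝ) (H : Fin m → HawkesRealization d) (k : ℕ)
    (X : HawkesParam d k) : ℝ :=
  (∑ r : Fin m, ∑ i : Fin (H r).n, Real.log (hawkesDot (hawkesA α (H r) i k) X)) -
    hawkesDot (hawkesB α H k) X

/-- The set of finite values of `L̂^k`. -/
def relaxedValues {d m : ℕ} (α : ℝ) (H : Fin m → HawkesRealization d) (k : ℕ) : Set ℝ :=
  relaxedLogLik α H k '' relaxedDomain α H k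

/-! ## MEMIP -/

/-- The warm start: the coefficients of order at most `k` are kept, those of order `k + 1` are
zero. -/
def warmStart {d k : ℕ} (X : HawkesParam d k) : HawkesParam d (k + 1) :=
  fun u v j => if hj : (j : ℕ) < k then X u v ⟨j, hj⟩ else 0

/-- An execution of MEMIP with `K` stages from the starting point `W₁`: stage `k` performs `n k`
Newton iterations on `L̂^k` and returns `X k`. -/
structure IsMemipRun {d m : ℕ} (a b ε α : ℝ) (H : Fin m → HawkesRealization d) (K : ℕ)
    (W₁ : HawkesParam d 1) (n : ℕ → ℕ) (X : (k : ℕ) → HawkesParam d k) : Prop where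
  first : IsNewtonArgMax a b ε (relaxedDomain α H 1) (relaxedLogLik α H 1) W₁ (n 1) (X 1)
  next : ∀ k, 1 ≤ k → k < K →
    IsNewtonArgMax a b ε (relaxedDomain α H (k + 1)) (relaxedLogLik α H (k + 1))
      (warmStart (X k)) (n (k + 1)) (X (k + 1))

end

/-! Along a line, p(t) = D²f(x+tv)[v,v] satisfies |p'| ≤ 2p^(3/2), so p^(-1/2) is 1-Lipschitz. All
analysis of Newton's method rests on this comparison (`abs_sqrt_hess_sub_le`). Write λ for the
Newton decrement.

It bounds the Hessian from above for short steps, so every step size t ≤ 1 with tλ at most a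
constant depending on `a` passes the line search (`sufficientDecrease`). Hence each iteration with λ
≥ η = `newtonRadius a` lowers f by at least abη², and such iterations number at most (abη²)⁻¹ times
the gap. Below η full steps are taken and λ₊ ≤ Mλ² with M = `newtonQuadFactor`
(`newtonStep_quadratic`), so Mλ ≤ 2^(-2^l) after l such steps and at most log₂ log₂(1/ε) of them
precede the stop. The same comparison bounds the Hessian from below, which gives f(x) - inf f ≤ λ²
when λ ≤ 1/2 (`le_add_sq_of_isNewtonDirection`). Closed sublevel sets keep the steps inside the
domain and, with boundedness below, make the Newton equation solvable even for a singular Hessian.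

The negative relaxed log-likelihood is a linear function plus a logarithmic barrier, hence
self-concordant with closed sublevel sets. A warm start has the likelihood value of the preceding
output, which is within ε of the preceding supremum, so the gaps of the stages telescope with a loss
of ε per stage. -/

open scoped BigOperators

noncomputable section

/-! ### Differential inequalities in one variable. -/

section Line

variable {p p' : ℝ → ℝ} {T : ℝ}

theorem add_mul_le_of_second_deriv_nonneg {g g' g'' : ℝ → ℝ} (hT : 0 ≤ T)
    (hg : ∀ t ∈ Set.Icc 0 T, HasDerivAt g (g' t) t)
    (hg' : ∀ t ∈ Set.Icc 0 T, HasDerivAt g' (g'' t) t)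
    (h : ∀ t ∈ Set.Icc 0 T, 0 ≤ g'' t) : g 0 + g' 0 * T ≤ g T := by
  have h0 : (0 : ℝ) ∈ Set.Icc 0 T := ⟨le_rfl, hT⟩
  have hTT : T ∈ Set.Icc 0 T := ⟨hT, le_rfl⟩
  have hmono : MonotoneOn g' (Set.Icc 0 T) := by
    refine monotoneOn_of_deriv_nonneg (convex_Icc 0 T)
      (fun t ht => (hg' t ht).continuousAt.continuousWithinAt) ?_ ?_
    · intro t ht
      exact (hg' t (interior_subset ht)).differentiableAt.differentiableWithinAt
    · intro t ht
      rw [(hg' t (interior_subset ht)).deriv]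
      exact h t (interior_subset ht)
  have hd : ∀ t ∈ Set.Icc 0 T, HasDerivAt (fun t => g t - g' 0 * t) (g' t - g' 0) t := by
    intro t ht
    exact (hg t ht).sub (by simpa using (hasDerivAt_id t).const_mul (g' 0))
  have hmono2 : MonotoneOn (fun t => g t - g' 0 * t) (Set.Icc 0 T) := by
    refine monotoneOn_of_deriv_nonneg (convex_Icc 0 T)
      (fun t ht => (hd t ht).continuousAt.continuousWithinAt) ?_ ?_
    · intro t ht
      exact (hd t (interior_subset ht)).differentiableAt.differentiableWithinAt
    · intro t ht
      have ht := interior_subset ht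
      rw [(hd t ht).deriv]
      exact sub_nonneg.2 (hmono h0 ht ht.1)
  have := hmono2 h0 hTT hT
  simp only [mul_zero, sub_zero] at this
  linarith

theorem le_add_sq_of_second_deriv_le {g g' g'' : ℝ → ℝ} {c : ℝ} (hT : 0 ≤ T)
    (hg : ∀ t ∈ Set.Icc 0 T, HasDerivAt g (g' t) t)
    (hg' : ∀ t ∈ Set.Icc 0 T, HasDerivAt g' (g'' t) t)
    (h : ∀ t ∈ Set.Icc 0 T, g'' t ≤ c) : g T ≤ g 0 + g' 0 * T + c * T ^ 2 / 2 := by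
  have := add_mul_le_of_second_deriv_nonneg (g := fun t => c * t ^ 2 / 2 - g t)
    (g' := fun t => c * t - g' t) (g'' := fun t => c - g'' t) hT ?_ ?_ ?_
  · simp only [ne_eq, OfNat.ofNat_ne_zero, not_false_eq_true, zero_pow, mul_zero, zero_div,
      zero_sub] at this
    linarith
  · intro t ht
    refine HasDerivAt.sub ?_ (hg t ht)
    have := (((hasDerivAt_id t).pow 2).const_mul c).div_const 2
    refine this.congr_deriv ?_
    simp
    ring
  · intro t ht
    refine HasDerivAt.sub ?_ (hg' t ht)
    simpa using (hasDerivAt_id t).const_mul c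
  · intro t ht
    exact sub_nonneg.2 (h t ht)

/-- The inverse square root of a function with `|p'| ≤ 2 p ^ (3 / 2)` is `1`-Lipschitz. -/
theorem abs_sqrt_sub_sqrt_le (hT : 0 ≤ T) (hp : ∀ t ∈ Set.Icc 0 T, 0 ≤ p t)
    (hd : ∀ t ∈ Set.Icc 0 T, HasDerivAt p (p' t) t)
    (hp' : ∀ t ∈ Set.Icc 0 T, |p' t| ≤ 2 * √(p t) ^ 3) :
    |√(p 0) - √(p T)| ≤ T * √(p 0) * √(p T) := by
  have h0 : (0 : ℝ) ∈ Set.Icc 0 T := ⟨le_rfl, hT⟩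
  have hTT : T ∈ Set.Icc 0 T := ⟨hT, le_rfl⟩
  -- Here p may vanish, so 1/√p need not exist. The shift by δ keeps the hypothesis on p', and the
  -- multiplicative form of the conclusion survives δ → 0.
  have key : ∀ δ > 0, |√(p 0 + δ) - √(p T + δ)| ≤ T * √(p 0 + δ) * √(p T + δ) := by
    intro δ hδ
    have hpos : ∀ t ∈ Set.Icc 0 T, 0 < √(p t + δ) := fun t ht =>
      Real.sqrt_pos.2 (by linarith [hp t ht])
    have hder : ∀ t ∈ Set.Icc 0 T, HasDerivWithinAt (fun t => (√(p t + δ))⁻¹)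
        (-(p' t / (2 * √(p t + δ))) / √(p t + δ) ^ 2) (Set.Icc 0 T) t := by
      intro t ht
      have h1 : p t + δ ≠ 0 := by linarith [hp t ht]
      exact ((((hd t ht).add_const δ).sqrt h1).inv (hpos t ht).ne').hasDerivWithinAt
    have hbound : ∀ t ∈ Set.Icc 0 T, ‖-(p' t / (2 * √(p t + δ))) / √(p t + δ) ^ 2‖ ≤ 1 := by
      intro t ht
      have hP := hpos t ht
      have hle : √(p t) ≤ √(p t + δ) := Real.sqrt_le_sqrt (by linarith)
      have h3 : √(p t) ^ 3 ≤ √(p t + δ) ^ 3 := by gcongr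
      rw [Real.norm_eq_abs, abs_div, abs_neg, abs_div, abs_of_pos (mul_pos two_pos hP),
        abs_of_pos (pow_pos hP 2), div_div, div_le_one (by positivity)]
      calc |p' t| ≤ 2 * √(p t) ^ 3 := hp' t ht
        _ ≤ 2 * √(p t + δ) * √(p t + δ) ^ 2 := by nlinarith
    have := (convex_Icc 0 T).norm_image_sub_le_of_norm_hasDerivWithin_le hder hbound h0 hTT
    rw [Real.norm_eq_abs, Real.norm_eq_abs, sub_zero, abs_of_nonneg hT, one_mul] at this
    have hA := hpos 0 h0
    have hB := hpos T hTT
    have heq : √(p 0 + δ) - √(p T + δ)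
        = ((√(p T + δ))⁻¹ - (√(p 0 + δ))⁻¹) * (√(p 0 + δ) * √(p T + δ)) := by
      field_simp
    rw [heq, abs_mul, abs_of_pos (mul_pos hA hB), mul_assoc]
    gcongr
  have hc0 : Filter.Tendsto (fun δ => √(p 0 + δ)) (nhdsWithin 0 (Set.Ioi 0)) (nhds √(p 0)) := by
    have : Continuous fun δ => √(p 0 + δ) := by fun_prop
    simpa using (this.tendsto 0).mono_left nhdsWithin_le_nhds
  have hcT : Filter.Tendsto (fun δ => √(p T + δ)) (nhdsWithin 0 (Set.Ioi 0)) (nhds √(p T)) := by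
    have : Continuous fun δ => √(p T + δ) := by fun_prop
    simpa using (this.tendsto 0).mono_left nhdsWithin_le_nhds
  refine le_of_tendsto_of_tendsto (hc0.sub hcT).abs ((hc0.const_mul T).mul hcT) ?_
  filter_upwards [self_mem_nhdsWithin] with δ hδ using key δ hδ

/-- The integrating factor exp(ct) makes p monotone. The comparison is with the right endpoint
because the quadratic estimate measures directions in the Hessian at the new iterate. -/
theorem le_mul_exp_of_deriv_ge {c : ℝ} (hT : 0 ≤ T)
    (hd : ∀ t ∈ Set.Icc 0 T, HasDerivAt p (p' t) t)
    (hp' : ∀ t ∈ Set.Icc 0 T, -(c * p t) ≤ p' t) {t : ℝ} (ht : t ∈ Set.Icc 0 T) :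
    p t ≤ p T * Real.exp (c * (T - t)) := by
  have hder : ∀ t ∈ Set.Icc 0 T, HasDerivAt (fun t => p t * Real.exp (c * t))
      ((p' t + c * p t) * Real.exp (c * t)) t := by
    intro t ht
    have h1 : HasDerivAt (fun t => Real.exp (c * t)) (Real.exp (c * t) * c) t := by
      simpa using ((hasDerivAt_id t).const_mul c).exp
    exact ((hd t ht).mul h1).congr_deriv (by ring)
  have hmono : MonotoneOn (fun t => p t * Real.exp (c * t)) (Set.Icc 0 T) := by
    refine monotoneOn_of_deriv_nonneg (convex_Icc 0 T)
      (fun t ht => (hder t ht).continuousAt.continuousWithinAt) ?_ ?_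
    · intro t ht
      exact (hder t (interior_subset ht)).differentiableAt.differentiableWithinAt
    · intro t ht
      have ht := interior_subset ht
      rw [(hder t ht).deriv]
      exact mul_nonneg (by linarith [hp' t ht]) (Real.exp_pos _).le
  have := hmono ht ⟨hT, le_rfl⟩ ht.2
  simp only at this
  rw [mul_sub, Real.exp_sub, mul_div_assoc', le_div_iff₀ (Real.exp_pos _)]
  exact this

end Line

/-! ### Second and third derivatives of a self-concordant function. -/

section Derivatives

variable {E : Type*} [NormedAddCommGroup E] [NormedSpace ℝ E]

/-- The second derivative as a continuous bilinear map. -/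
abbrev hess (f : E → ℝ) (x : E) : E →L[ℝ] E →L[ℝ] ℝ := fderiv ℝ (fderiv ℝ f) x

/-- The third derivative as a continuous trilinear map. -/
abbrev third (f : E → ℝ) (x : E) : E →L[ℝ] E →L[ℝ] E →L[ℝ] ℝ :=
  fderiv ℝ (fderiv ℝ (fderiv ℝ f)) x

theorem iteratedFDeriv_two_eq_hess (f : E → ℝ) (x v w : E) :
    iteratedFDeriv ℝ 2 f x ![v, w] = hess f x v w := by
  simp [iteratedFDeriv_two_apply]

theorem iteratedFDeriv_three_eq_third (f : E → ℝ) (x u v w : E) :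
    iteratedFDeriv ℝ 3 f x ![u, v, w] = third f x u v w := by
  rw [iteratedFDeriv_succ_apply_right, iteratedFDeriv_two_apply]
  rfl

theorem hasDerivAt_line (x v : E) (t : ℝ) : HasDerivAt (fun t : ℝ => x + t • v) v t := by
  simpa using ((hasDerivAt_id t).smul_const v).const_add x

variable {D : Set E} {f : E → ℝ}

/-- Polarization: (v+w)³ + (v-w)³ - 2v³ = 6vw² for a symmetric trilinear form. For unit vectors the
parallelogram law gives B(v±w, v±w) ≤ 4, hence (16 + 16 + 4)/6 = 6. The constant is not sharp, which
affects only the value of M. -/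
theorem abs_third_le_of_abs_cube_le {T : E →L[ℝ] E →L[ℝ] E →L[ℝ] ℝ} {B : E →L[ℝ] E →L[ℝ] ℝ}
    (hT₁ : ∀ u v w, T u v w = T v u w) (hT₂ : ∀ u v w, T u v w = T u w v)
    (hB : ∀ v, 0 ≤ B v v) (h : ∀ v, |T v v v| ≤ 2 * √(B v v) ^ 3) (v w : E) :
    |T v w w| ≤ 6 * √(B v v) * B w w := by
  have unit : ∀ v w, B v v ≤ 1 → B w w ≤ 1 → |T v w w| ≤ 6 := by
    intro v w hv hw
    have hpar : B (v + w) (v + w) + B (v - w) (v - w) = 2 * B v v + 2 * B w w := by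
      simp only [map_add, map_sub, add_apply, sub_apply]
      ring
    have hpol : 6 * T v w w =
        T (v + w) (v + w) (v + w) + T (v - w) (v - w) (v - w) - 2 * T v v v := by
      simp only [map_add, map_sub, add_apply, sub_apply]
      rw [hT₁ w v w, hT₂ w w v, hT₁ w v w, hT₂ v w v]
      ring
    have hcube : ∀ z (r : ℝ), 0 ≤ r → B z z ≤ r ^ 2 → |T z z z| ≤ 2 * r ^ 3 := by
      intro z r hr hz
      have : √(B z z) ≤ r := Real.sqrt_le_iff.2 ⟨hr, hz⟩
      exact (h z).trans (by gcongr)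
    have h1 := abs_le.1 (hcube (v + w) 2 (by norm_num) (by linarith [hB (v - w)]))
    have h2 := abs_le.1 (hcube (v - w) 2 (by norm_num) (by linarith [hB (v + w)]))
    have h3 := abs_le.1 (hcube v 1 (by norm_num) (by linarith))
    rw [abs_le]
    constructor <;> linarith [h1.1, h1.2, h2.1, h2.2, h3.1, h3.2]
  have scaled : ∀ δ > 0, |T v w w| ≤ 6 * (√(B v v) + δ) * (√(B w w) + δ) ^ 2 := by
    intro δ hδ
    -- Normalizing by √B(z,z) + δ covers vectors on which B vanishes; δ tends to 0 at the end.
    have small : ∀ z, B ((√(B z z) + δ)⁻¹ • z) ((√(B z z) + δ)⁻¹ • z) ≤ 1 := by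
      intro z
      have hs : 0 < √(B z z) + δ := add_pos_of_nonneg_of_pos (Real.sqrt_nonneg _) hδ
      simp only [map_smul, smul_apply, smul_eq_mul]
      rw [← mul_assoc, ← mul_inv, inv_mul_le_one₀ (mul_pos hs hs)]
      nlinarith [Real.mul_self_sqrt (hB z), Real.sqrt_nonneg (B z z)]
    have hp : 0 < √(B v v) + δ := add_pos_of_nonneg_of_pos (Real.sqrt_nonneg _) hδ
    have hq : 0 < √(B w w) + δ := add_pos_of_nonneg_of_pos (Real.sqrt_nonneg _) hδ
    have := unit _ _ (small v) (small w)
    simp only [map_smul, smul_apply, smul_eq_mul] at this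
    rw [show (√(B w w) + δ)⁻¹ * ((√(B w w) + δ)⁻¹ * ((√(B v v) + δ)⁻¹ * T v w w))
      = T v w w / ((√(B v v) + δ) * (√(B w w) + δ) ^ 2) by field_simp, abs_div,
      abs_of_pos (by positivity : 0 < (√(B v v) + δ) * (√(B w w) + δ) ^ 2),
      div_le_iff₀ (by positivity)] at this
    linarith
  have hc : Filter.Tendsto (fun δ => 6 * (√(B v v) + δ) * (√(B w w) + δ) ^ 2)
      (nhdsWithin 0 (Set.Ioi 0)) (nhds (6 * √(B v v) * B w w)) := by
    have : Continuous fun δ => 6 * (√(B v v) + δ) * (√(B w w) + δ) ^ 2 := by fun_prop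
    have := (this.tendsto 0).mono_left (nhdsWithin_le_nhds (s := Set.Ioi 0))
    simpa [Real.sq_sqrt (hB w)] using this
  refine ge_of_tendsto hc ?_
  filter_upwards [self_mem_nhdsWithin] with δ hδ using scaled δ hδ

theorem abs_bilin_le {B : E →L[ℝ] E →L[ℝ] ℝ} (hsymm : ∀ v w, B v w = B w v)
    (hB : ∀ v, 0 ≤ B v v) (v w : E) : |B v w| ≤ √(B v v) * √(B w w) := by
  have hd : discrim (B w w) (2 * B v w) (B v v) ≤ 0 := by
    refine discrim_le_zero fun t => ?_
    have := hB (v + t • w)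
    simp only [map_add, map_smul, add_apply, smul_apply,
      smul_eq_mul, hsymm w v] at this
    linarith
  rw [← Real.sqrt_mul (hB v)]
  apply Real.abs_le_sqrt
  unfold discrim at hd
  linarith

namespace SelfConcordantOn

theorem contDiffAt (hf : SelfConcordantOn D f) {x : E} (hx : x ∈ D) : ContDiffAt ℝ 3 f x :=
  hf.contDiffOn.contDiffAt (hf.isOpen.mem_nhds hx)

theorem hasFDerivAt (hf : SelfConcordantOn D f) {x : E} (hx : x ∈ D) :
    HasFDerivAt f (fderiv ℝ f x) x :=
  ((hf.contDiffAt hx).differentiableAt (by norm_num)).hasFDerivAt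

theorem contDiffAt_fderiv (hf : SelfConcordantOn D f) {x : E} (hx : x ∈ D) :
    ContDiffAt ℝ 2 (fderiv ℝ f) x :=
  (hf.contDiffAt hx).fderiv_right (by norm_num)

theorem hasFDerivAt_fderiv (hf : SelfConcordantOn D f) {x : E} (hx : x ∈ D) :
    HasFDerivAt (fderiv ℝ f) (hess f x) x :=
  ((hf.contDiffAt_fderiv hx).differentiableAt (by norm_num)).hasFDerivAt

theorem hasFDerivAt_hess (hf : SelfConcordantOn D f) {x : E} (hx : x ∈ D) :
    HasFDerivAt (hess f) (third f x) x :=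
  (((hf.contDiffAt_fderiv hx).fderiv_right (m := 1) (by norm_num)).differentiableAt
    (by norm_num)).hasFDerivAt

theorem hasDerivAt_comp_line (hf : SelfConcordantOn D f) {x v : E} {t : ℝ}
    (hx : x + t • v ∈ D) :
    HasDerivAt (fun t : ℝ => f (x + t • v)) (fderiv ℝ f (x + t • v) v) t :=
  (hf.hasFDerivAt hx).comp_hasDerivAt t (hasDerivAt_line x v t)

theorem hasDerivAt_fderiv_line (hf : SelfConcordantOn D f) {x v : E} (w : E) {t : ℝ}
    (hx : x + t • v ∈ D) :
    HasDerivAt (fun t : ℝ => fderiv ℝ f (x + t • v) w) (hess f (x + t • v) v w) t := by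
  have h : HasDerivAt (fun t : ℝ => fderiv ℝ f (x + t • v)) (hess f (x + t • v) v) t :=
    (hf.hasFDerivAt_fderiv hx).comp_hasDerivAt t (hasDerivAt_line x v t)
  simpa using h.clm_apply (hasDerivAt_const t w)

theorem hasDerivAt_hess_line (hf : SelfConcordantOn D f) {x v : E} (w w' : E) {t : ℝ}
    (hx : x + t • v ∈ D) :
    HasDerivAt (fun t : ℝ => hess f (x + t • v) w w') (third f (x + t • v) v w w') t := by
  have h : HasDerivAt (fun t : ℝ => hess f (x + t • v)) (third f (x + t • v) v) t :=
    HasFDerivAt.comp_hasDerivAt (l := fun y => hess f y) t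
      (hf.hasFDerivAt_hess hx) (hasDerivAt_line x v t)
  have h' : HasDerivAt (fun t : ℝ => hess f (x + t • v) w) (third f (x + t • v) v w) t := by
    simpa using h.clm_apply (hasDerivAt_const t w)
  simpa using h'.clm_apply (hasDerivAt_const t w')

theorem hess_symm (hf : SelfConcordantOn D f) {x : E} (hx : x ∈ D) (v w : E) :
    hess f x v w = hess f x w v :=
  ((hf.contDiffAt hx).isSymmSndFDerivAt (by simp; norm_num)) v w

theorem third_swap_left (hf : SelfConcordantOn D f) {x : E} (hx : x ∈ D) (u v w : E) :
    third f x u v w = third f x v u w :=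
  congrArg (fun L => L w) (((hf.contDiffAt_fderiv hx).isSymmSndFDerivAt (by simp)) u v)

/-- Both sides are derivatives along u of the same function, by symmetry of the Hessian near x. -/
theorem third_swap_right (hf : SelfConcordantOn D f) {x : E} (hx : x ∈ D) (u v w : E) :
    third f x u v w = third f x u w v := by
  have hx0 : x + (0 : ℝ) • u ∈ D := by simpa using hx
  have h1 := hf.hasDerivAt_hess_line v w hx0
  have h2 := hf.hasDerivAt_hess_line w v hx0
  have hev : (fun t : ℝ => hess f (x + t • u) w v) =ᶠ[nhds 0]
      fun t : ℝ => hess f (x + t • u) v w := by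
    have hc : ContinuousAt (fun t : ℝ => x + t • u) 0 := (hasDerivAt_line x u 0).continuousAt
    filter_upwards [hc (hf.isOpen.mem_nhds hx0)] with t ht using hf.hess_symm ht w v
  simpa using (h1.congr_of_eventuallyEq hev).unique h2

theorem hess_nonneg (hf : SelfConcordantOn D f) {x : E} (hx : x ∈ D) (v : E) :
    0 ≤ hess f x v v := by
  set I : Set ℝ := {t | x + t • v ∈ D} with hI
  have hx0 : x + (0 : ℝ) • v ∈ D := by simpa using hx
  have hIn : I ∈ nhds (0 : ℝ) :=
    (hasDerivAt_line x v 0).continuousAt (hf.isOpen.mem_nhds hx0)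
  have hconv : ConvexOn ℝ I fun t : ℝ => f (x + t • v) := by
    have hcomb : ∀ (s t p q : ℝ), p + q = 1 →
        x + (p • s + q • t) • v = p • (x + s • v) + q • (x + t • v) := by
      intro s t p q hpq
      obtain rfl : q = 1 - p := by linarith
      module
    refine ⟨fun s hs t ht p q hp hq hpq => ?_, fun s hs t ht p q hp hq hpq => ?_⟩
    · rw [hI, Set.mem_ofPred_eq, hcomb s t p q hpq]
      exact hf.convexOn.1 hs ht hp hq hpq
    · simp only [hcomb s t p q hpq]
      exact hf.convexOn.2 hs ht hp hq hpq
  have hmono := hconv.monotoneOn_deriv fun t ht => (hf.hasDerivAt_comp_line ht).differentiableAt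
  have hmono' : MonotoneOn (fun t : ℝ => fderiv ℝ f (x + t • v) v) I := by
    refine hmono.congr fun t ht => ?_
    exact (hf.hasDerivAt_comp_line ht).deriv
  have h1 := hmono'.derivWithin_nonneg (x := 0)
  rw [derivWithin_of_mem_nhds hIn, (hf.hasDerivAt_fderiv_line v hx0).deriv] at h1
  simpa using h1

theorem abs_third_cube_le (hf : SelfConcordantOn D f) {x : E} (hx : x ∈ D) (v : E) :
    |third f x v v v| ≤ 2 * √(hess f x v v) ^ 3 := by
  have h := hf.third_le x hx v
  rw [iteratedFDeriv_three_eq_third, iteratedFDeriv_two_eq_hess] at h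
  rwa [Real.sqrt_eq_rpow, ← Real.rpow_natCast, ← Real.rpow_mul (hf.hess_nonneg hx v),
    show (1 / 2 : ℝ) * (3 : ℕ) = 3 / 2 by norm_num]

theorem abs_third_le (hf : SelfConcordantOn D f) {x : E} (hx : x ∈ D) (v w : E) :
    |third f x v w w| ≤ 6 * √(hess f x v v) * hess f x w w :=
  abs_third_le_of_abs_cube_le (hf.third_swap_left hx) (hf.third_swap_right hx)
    (hf.hess_nonneg hx) (hf.abs_third_cube_le hx) v w

theorem abs_hess_le (hf : SelfConcordantOn D f) {x : E} (hx : x ∈ D) (v w : E) :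
    |hess f x v w| ≤ √(hess f x v v) * √(hess f x w w) :=
  abs_bilin_le (hf.hess_symm hx) (hf.hess_nonneg hx) v w

theorem abs_sqrt_hess_sub_le (hf : SelfConcordantOn D f) {x v : E} {T : ℝ} (hT : 0 ≤ T)
    (hD : ∀ t ∈ Set.Icc 0 T, x + t • v ∈ D) :
    |√(hess f x v v) - √(hess f (x + T • v) v v)| ≤
      T * √(hess f x v v) * √(hess f (x + T • v) v v) := by
  have := abs_sqrt_sub_sqrt_le (p := fun t => hess f (x + t • v) v v) hT
    (fun t ht => hf.hess_nonneg (hD t ht) v) (fun t ht => hf.hasDerivAt_hess_line v v (hD t ht))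
    (fun t ht => hf.abs_third_cube_le (hD t ht) v)
  simpa using this

end SelfConcordantOn

end Derivatives

/-! ### A single Newton iteration and the optimality gap. -/

section NewtonAnalysis

variable {E : Type*} [NormedAddCommGroup E] [NormedSpace ℝ E] {D : Set E} {f : E → ℝ}

theorem isNewtonDirection_iff {x v : E} :
    IsNewtonDirection f x v ↔ ∀ w, hess f x v w = -fderiv ℝ f x w := by
  simp only [IsNewtonDirection, iteratedFDeriv_two_eq_hess]

theorem newtonStops_iff {ε : ℝ} {x : E} :
    NewtonStops f ε x ↔
      ∃ v, IsNewtonDirection f x v ∧ hess f x v v ≤ ε ∧ hess f x v v ≤ 1 / 4 := by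
  simp only [NewtonStops, iteratedFDeriv_two_eq_hess]

/-- Expanding the logarithm to order four leaves a remainder of at most 2x⁵, and 1/2 + 1/6 + 1/16 +
1/4 < 1. -/
theorem neg_sub_log_one_sub_le_sq {x : ℝ} (h0 : 0 ≤ x) (h1 : x ≤ 1 / 2) :
    -x - Real.log (1 - x) ≤ x ^ 2 := by
  have h := Real.abs_log_sub_add_sum_range_le (x := x) (by rw [abs_of_nonneg h0]; linarith) 4
  rw [abs_of_nonneg h0] at h
  have h2 : x ^ (4 + 1) / (1 - x) ≤ 2 * x ^ 5 := by
    rw [div_le_iff₀ (by linarith)]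
    have := mul_nonneg (pow_nonneg h0 5) (by linarith : 0 ≤ 1 - 2 * x)
    norm_num
    linarith
  have h3 := (abs_le.1 (h.trans h2)).1
  simp only [Finset.sum_range_succ, Finset.sum_range_zero] at h3
  norm_num at h3
  have h4 : x ^ 3 ≤ x ^ 2 * (1 / 2) := by nlinarith [sq_nonneg x]
  have h5 : x ^ 4 ≤ x ^ 2 * (1 / 4) := by nlinarith [sq_nonneg x]
  have h6 : x ^ 5 ≤ x ^ 2 * (1 / 8) := by nlinarith [sq_nonneg x]
  nlinarith [sq_nonneg x]

namespace SelfConcordantOn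

theorem add_smul_mem (hf : SelfConcordantOn D f) {x v : E} {t s : ℝ} (hx : x ∈ D)
    (ht : x + t • v ∈ D) (hs : s ∈ Set.Icc 0 t) : x + s • v ∈ D := by
  rcases hs.1.eq_or_lt with rfl | h0
  · simpa using hx
  have htp : 0 < t := h0.trans_le hs.2
  have := hf.convexOn.1.add_smul_mem hx ht
    (t := s / t) ⟨div_nonneg h0.le htp.le, (div_le_one htp).2 hs.2⟩
  rwa [smul_smul, div_mul_cancel₀ _ htp.ne'] at this

/-- Continuous induction: the times at which the ray is in the sublevel set form a closed set, and
openness of D with the a priori decrease extends it to the right. -/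
theorem line_mem_of_isClosed_sublevel (hf : SelfConcordantOn D f) {x v : E} {c T : ℝ}
    (hcl : IsClosed {x | x ∈ D ∧ f x ≤ c}) (hx : x ∈ D) (hxc : f x ≤ c)
    (h : ∀ t ∈ Set.Icc 0 T, (∀ s ∈ Set.Icc 0 t, x + s • v ∈ D) → f (x + t • v) ≤ f x) :
    ∀ t ∈ Set.Icc 0 T, x + t • v ∈ D := by
  have hcont : Continuous fun t : ℝ => x + t • v := by fun_prop
  have hsub : Set.Icc 0 T ⊆ (fun t : ℝ => x + t • v) ⁻¹' {x | x ∈ D ∧ f x ≤ c} := by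
    refine ((hcl.preimage hcont).inter isClosed_Icc).Icc_subset_of_forall_exists_gt ?_ ?_
    · simpa using ⟨hx, hxc⟩
    · rintro t ⟨ht, ht0, htT⟩ y hy
      have h1 : ∀ᶠ s in nhdsWithin t (Set.Ioi t), x + s • v ∈ D :=
        (hcont.continuousAt.eventually (hf.isOpen.mem_nhds ht.1)).filter_mono nhdsWithin_le_nhds
      have h2 : ∀ᶠ s in nhdsWithin t (Set.Ioi t), s ∈ Set.Ioo t (min y T) :=
        Ioo_mem_nhdsGT (lt_min hy htT)
      obtain ⟨s, hsD, hts, hsy⟩ := (h1.and h2).exists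
      have hs := lt_min_iff.1 hsy
      refine ⟨s, ⟨hsD, (h s ⟨ht0.trans hts.le, hs.2.le⟩ fun r hr => ?_).trans hxc⟩, hts, hs.1.le⟩
      exact hf.add_smul_mem hx hsD hr
  exact fun t ht => (hsub ht).1

/-- By the square root comparison, a direction in the kernel of the Hessian at x has zero curvature
all along its line. A nonzero slope would then let f decrease linearly forever in v or -v, against
boundedness below. -/
theorem fderiv_eq_zero_of_hess_eq_zero (hf : SelfConcordantOn D f) {x v : E} {c : ℝ}
    (hcl : IsClosed {x | x ∈ D ∧ f x ≤ c}) (hbdd : BddBelow (f '' D)) (hx : x ∈ D)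
    (hxc : f x ≤ c) (hv : hess f x v = 0) : fderiv ℝ f x v = 0 := by
  suffices ∀ v, hess f x v = 0 → 0 ≤ fderiv ℝ f x v by
    refine le_antisymm ?_ (this v hv)
    have := this (-v) (by rw [map_neg, hv, neg_zero])
    rwa [map_neg, le_neg, neg_zero] at this
  clear hv v
  intro v hv
  by_contra! hneg
  obtain ⟨m, hm⟩ := hbdd
  have hbound : ∀ t, 0 ≤ t → (∀ s ∈ Set.Icc 0 t, x + s • v ∈ D) →
      f (x + t • v) ≤ f x + fderiv ℝ f x v * t := by
    intro t ht hD
    have hz : ∀ s ∈ Set.Icc 0 t, hess f (x + s • v) v v ≤ 0 := by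
      intro s hs
      have := hf.abs_sqrt_hess_sub_le (x := x) (v := v) hs.1
        fun r hr => hD r ⟨hr.1, hr.2.trans hs.2⟩
      simp only [hv, zero_apply, Real.sqrt_zero, mul_zero, zero_mul, zero_sub, abs_neg] at this
      exact Real.sqrt_eq_zero'.1 (abs_nonpos_iff.1 this)
    have := le_add_sq_of_second_deriv_le ht (fun s hs => hf.hasDerivAt_comp_line (hD s hs))
      (fun s hs => hf.hasDerivAt_fderiv_line v (hD s hs)) hz
    simpa using this
  set T := (f x - m + 1) / -fderiv ℝ f x v with hT
  have hfx : m ≤ f x := hm ⟨x, hx, rfl⟩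
  have hT0 : 0 ≤ T := div_nonneg (by linarith) (by linarith)
  have hmem := hf.line_mem_of_isClosed_sublevel (v := v) (T := T) hcl hx hxc fun t ht hD =>
    (hbound t ht.1 hD).trans (by nlinarith [ht.1])
  have h1 := hbound T hT0 hmem
  have h2 : m ≤ f (x + T • v) := hm ⟨_, hmem T ⟨hT0, le_rfl⟩, rfl⟩
  have h3 : fderiv ℝ f x v * T = -(f x - m + 1) := by
    rw [hT, div_neg, mul_neg, mul_div_cancel₀ _ hneg.ne]
  linarith

theorem exists_isNewtonDirection [FiniteDimensional ℝ E] (hf : SelfConcordantOn D f) {x : E}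
    {c : ℝ} (hcl : IsClosed {x | x ∈ D ∧ f x ≤ c}) (hbdd : BddBelow (f '' D)) (hx : x ∈ D)
    (hxc : f x ≤ c) : ∃ v, IsNewtonDirection f x v := by
  set B : E →ₗ[ℝ] Module.Dual ℝ E :=
    (ContinuousLinearMap.coeLM ℝ).comp (hess f x : E →ₗ[ℝ] E →L[ℝ] ℝ) with hB
  -- In finite dimension the range of the transpose is the annihilator of the kernel, so it is
  -- enough that the gradient kills the kernel of the Hessian.
  have hmem : (fderiv ℝ f x : Module.Dual ℝ E) ∈ LinearMap.range B.flip := by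
    rw [← LinearMap.dualAnnihilator_ker_eq_range_flip, Submodule.mem_dualAnnihilator]
    intro v hv
    refine hf.fderiv_eq_zero_of_hess_eq_zero hcl hbdd hx hxc ?_
    ext w
    exact congrArg (fun L : Module.Dual ℝ E => L w) (LinearMap.mem_ker.1 hv)
  obtain ⟨v, hv⟩ := hmem
  refine ⟨-v, isNewtonDirection_iff.2 fun w => ?_⟩
  have : hess f x w v = fderiv ℝ f x w := congrArg (fun L : Module.Dual ℝ E => L w) hv
  rw [map_neg, neg_apply, hf.hess_symm hx, this]

theorem sufficientDecrease_of_segment_mem (hf : SelfConcordantOn D f) {a s t : ℝ} {x v : E}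
    (hs1 : s < 1) (has : 1 ≤ 2 * (1 - a) * (1 - s) ^ 2) (hv : IsNewtonDirection f x v)
    (ht0 : 0 ≤ t) (ht1 : t ≤ 1) (hts : t * √(hess f x v v) ≤ s)
    (hD : ∀ r ∈ Set.Icc 0 t, x + r • v ∈ D) :
    f (x + t • v) ≤ f x + a * t * fderiv ℝ f x v := by
  have hx : x ∈ D := by simpa using hD 0 ⟨le_rfl, ht0⟩
  set l := √(hess f x v v) with hl
  have hl0 : 0 ≤ l := Real.sqrt_nonneg _
  have hl2 : l ^ 2 = hess f x v v := Real.sq_sqrt (hf.hess_nonneg hx v)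
  have hg : fderiv ℝ f x v = -l ^ 2 := by
    rw [hl2, isNewtonDirection_iff.1 hv v, neg_neg]
  -- The comparison gives q ≤ l/(1-s), and the condition on s is exactly 1/(1-s)² ≤ 2(1-a). Taylor
  -- then yields a change of at most -tl² + (1-a)t²l² ≤ -atl² for t ≤ 1.
  have hsec : ∀ r ∈ Set.Icc 0 t, hess f (x + r • v) v v ≤ 2 * (1 - a) * l ^ 2 := by
    intro r hr
    have h1 := hf.abs_sqrt_hess_sub_le (x := x) (v := v) hr.1
      fun r' hr' => hD r' ⟨hr'.1, hr'.2.trans hr.2⟩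
    rw [← hl] at h1
    have hq := Real.sq_sqrt (hf.hess_nonneg (hD r hr) v)
    have hq0 := Real.sqrt_nonneg (hess f (x + r • v) v v)
    set q := √(hess f (x + r • v) v v)
    have hrl : r * l ≤ s := (mul_le_mul_of_nonneg_right hr.2 hl0).trans hts
    have h2 : q * (1 - s) ≤ l := by
      have := (abs_le.1 h1).1
      nlinarith
    have h3 : (q * (1 - s)) ^ 2 ≤ l ^ 2 :=
      pow_le_pow_left₀ (mul_nonneg hq0 (by linarith)) h2 2
    have h4 : q ^ 2 * 1 ≤ q ^ 2 * (2 * (1 - a) * (1 - s) ^ 2) := by gcongr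
    have ha : 0 ≤ 2 * (1 - a) := by
      by_contra! hneg
      nlinarith [sq_nonneg (1 - s)]
    nlinarith
  have := le_add_sq_of_second_deriv_le ht0 (fun r hr => hf.hasDerivAt_comp_line (hD r hr))
    (fun r hr => hf.hasDerivAt_fderiv_line v (hD r hr)) hsec
  simp only [zero_smul, add_zero] at this
  rw [hg] at this ⊢
  have ha : 0 ≤ 1 - a := by
    by_contra! hneg
    nlinarith [sq_nonneg (1 - s)]
  have h5 : t * (1 - t) * ((1 - a) * l ^ 2) ≥ 0 :=
    mul_nonneg (mul_nonneg ht0 (by linarith)) (mul_nonneg ha (sq_nonneg l))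
  nlinarith

theorem sufficientDecrease (hf : SelfConcordantOn D f) {a s t c : ℝ} {x v : E} (ha : 0 ≤ a)
    (hs1 : s < 1) (has : 1 ≤ 2 * (1 - a) * (1 - s) ^ 2)
    (hcl : IsClosed {x | x ∈ D ∧ f x ≤ c}) (hx : x ∈ D) (hxc : f x ≤ c)
    (hv : IsNewtonDirection f x v)
    (ht0 : 0 ≤ t) (ht1 : t ≤ 1) (hts : t * √(hess f x v v) ≤ s) :
    (∀ r ∈ Set.Icc 0 t, x + r • v ∈ D) ∧ SufficientDecrease a D f x v t := by
  have hg : fderiv ℝ f x v ≤ 0 := by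
    have := isNewtonDirection_iff.1 hv v
    linarith [hf.hess_nonneg hx v]
  have hD : ∀ r ∈ Set.Icc 0 t, x + r • v ∈ D := by
    refine hf.line_mem_of_isClosed_sublevel hcl hx hxc fun r hr hD => ?_
    refine (hf.sufficientDecrease_of_segment_mem hs1 has hv hr.1 (hr.2.trans ht1)
      ((mul_le_mul_of_nonneg_right hr.2 (Real.sqrt_nonneg _)).trans hts) hD).trans ?_
    have := mul_nonneg ha hr.1
    nlinarith
  exact ⟨hD, hD t ⟨ht0, le_rfl⟩,
    hf.sufficientDecrease_of_segment_mem hs1 has hv ht0 ht1 hts hD⟩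

theorem exists_newtonStep [FiniteDimensional ℝ E] (hf : SelfConcordantOn D f) {a b s c : ℝ}
    {x : E} (ha : 0 ≤ a) (hb0 : 0 < b) (hb1 : b < 1) (hs0 : 0 < s)
    (hs1 : s < 1) (has : 1 ≤ 2 * (1 - a) * (1 - s) ^ 2)
    (hcl : IsClosed {x | x ∈ D ∧ f x ≤ c}) (hbdd : BddBelow (f '' D)) (hx : x ∈ D)
    (hxc : f x ≤ c) : ∃ y, NewtonStep a b D f x y := by
  classical
  obtain ⟨v, hv⟩ := hf.exists_isNewtonDirection hcl hbdd hx hxc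
  have hex : ∃ m : ℕ, SufficientDecrease a D f x v (b ^ m) := by
    have hpos : 0 < √(hess f x v v) + 1 := by positivity
    obtain ⟨m, hm⟩ := exists_pow_lt_of_lt_one (div_pos hs0 hpos) hb1
    refine ⟨m, (hf.sufficientDecrease ha hs1 has hcl hx hxc hv (pow_nonneg hb0.le m)
      (pow_le_one₀ hb0.le hb1.le) ?_).2⟩
    rw [lt_div_iff₀ hpos] at hm
    nlinarith [pow_pos hb0 m]
  exact ⟨_, v, hv, Nat.find hex, Nat.find_spec hex, fun j hj => Nat.find_min hex hj, rfl⟩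

theorem newtonStep_mem_le (hf : SelfConcordantOn D f) {a b : ℝ} {x y : E} (ha : 0 ≤ a)
    (hb : 0 ≤ b) (hx : x ∈ D) (h : NewtonStep a b D f x y) : y ∈ D ∧ f y ≤ f x := by
  obtain ⟨v, hv, m, ⟨hD, hle⟩, -, rfl⟩ := h
  refine ⟨hD, hle.trans ?_⟩
  have := isNewtonDirection_iff.1 hv v
  have hg : fderiv ℝ f x v ≤ 0 := by linarith [hf.hess_nonneg hx v]
  nlinarith [mul_nonneg ha (pow_nonneg hb m)]

/-- Both values equal D²f(x)[v,w], so decrement bounds transfer to whichever direction the step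
uses. -/
theorem hess_eq_of_isNewtonDirection (hf : SelfConcordantOn D f) {x v w : E} (hx : x ∈ D)
    (hv : IsNewtonDirection f x v) (hw : IsNewtonDirection f x w) :
    hess f x v v = hess f x w w := by
  rw [isNewtonDirection_iff.1 hv v, ← isNewtonDirection_iff.1 hw v, hf.hess_symm hx,
    isNewtonDirection_iff.1 hv w, ← isNewtonDirection_iff.1 hw w]

theorem newtonStep_damped (hf : SelfConcordantOn D f) {a b s c η : ℝ} {x y v : E} (ha : 0 ≤ a)
    (hb0 : 0 < b) (hb1 : b < 1) (hη : 0 ≤ η) (hηs : η ≤ s)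
    (hs1 : s < 1) (has : 1 ≤ 2 * (1 - a) * (1 - s) ^ 2)
    (hcl : IsClosed {x | x ∈ D ∧ f x ≤ c}) (hx : x ∈ D) (hxc : f x ≤ c)
    (hv : IsNewtonDirection f x v) (hvη : η ≤ √(hess f x v v))
    (h : NewtonStep a b D f x y) : f y ≤ f x - a * b * η ^ 2 := by
  obtain ⟨w, hw, m, ⟨hD, hle⟩, hmin, rfl⟩ := h
  rw [hf.hess_eq_of_isNewtonDirection hx hv hw] at hvη
  set l := √(hess f x w w) with hl
  have hl2 : l ^ 2 = hess f x w w := Real.sq_sqrt (hf.hess_nonneg hx w)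
  have hg : fderiv ℝ f x w = -l ^ 2 := by
    rw [hl2, isNewtonDirection_iff.1 hw w, neg_neg]
  -- Either the full step was taken, or the preceding trial b^j was rejected, which forces b^j l ≥ s
  -- ≥ η; one more factor b is lost.
  have hbm : b * η ^ 2 ≤ b ^ m * l ^ 2 := by
    rcases m with _ | j
    · rw [pow_zero]
      gcongr
    · have hj : s ≤ b ^ j * l := by
        by_contra! hlt
        exact hmin j j.lt_succ_self (hf.sufficientDecrease ha hs1 has hcl hx hxc hw
          (pow_nonneg hb0.le j) (pow_le_one₀ hb0.le hb1.le) hlt.le).2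
      calc b * η ^ 2 = b * (η * η) := by ring
        _ ≤ b * ((b ^ j * l) * l) := by gcongr; exact hηs.trans hj
        _ = b ^ (j + 1) * l ^ 2 := by ring
  rw [hg] at hle
  nlinarith

theorem newtonStep_quadratic (hf : SelfConcordantOn D f) {a b s c : ℝ} {x y v w : E}
    (ha : 0 ≤ a) (hs : s ≤ 1 / 4) (has : 1 ≤ 2 * (1 - a) * (1 - s) ^ 2)
    (hcl : IsClosed {x | x ∈ D ∧ f x ≤ c}) (hx : x ∈ D) (hxc : f x ≤ c)
    (hv : IsNewtonDirection f x v) (hvs : √(hess f x v v) ≤ s)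
    (h : NewtonStep a b D f x y) (hw : IsNewtonDirection f y w) :
    √(hess f y w w) ≤ 24 * Real.exp 3 * √(hess f x v v) ^ 2 := by
  obtain ⟨u, hu, m, ⟨hy, -⟩, hmin, rfl⟩ := h
  rw [hf.hess_eq_of_isNewtonDirection hx hv hu] at hvs ⊢
  clear hv v
  obtain ⟨hseg, hdec⟩ := hf.sufficientDecrease (t := 1) ha (by linarith) has hcl hx hxc hu
    zero_le_one le_rfl (by simpa using hvs)
  obtain rfl : m = 0 := by
    by_contra hm
    exact hmin 0 (Nat.pos_of_ne_zero hm) (by simpa using hdec)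
  rw [pow_zero] at *
  set l := √(hess f x u u) with hl
  have hl0 : 0 ≤ l := Real.sqrt_nonneg _
  have hlt : ∀ t ∈ Set.Icc (0 : ℝ) 1, √(hess f (x + t • u) u u) ≤ 2 * l := by
    intro t ht
    have h1 := hf.abs_sqrt_hess_sub_le (x := x) (v := u) ht.1
      fun r hr => hseg r ⟨hr.1, hr.2.trans ht.2⟩
    rw [← hl] at h1
    have hq0 := Real.sqrt_nonneg (hess f (x + t • u) u u)
    set q := √(hess f (x + t • u) u u)
    have htl : t * l ≤ 1 / 4 := by nlinarith [ht.1, ht.2]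
    have := (abs_le.1 h1).1
    nlinarith
  -- As 2l ≤ 1, the mixed third derivative bound makes the Hessian in direction w change at
  -- logarithmic rate at most 6; the square root halves the exponent to 3.
  have hwt : ∀ t ∈ Set.Icc (0 : ℝ) 1,
      √(hess f (x + t • u) w w) ≤ √(hess f (x + (1 : ℝ) • u) w w) * Real.exp 3 := by
    intro t ht
    have h1 := le_mul_exp_of_deriv_ge (c := 6) zero_le_one
      (fun t ht => hf.hasDerivAt_hess_line w w (hseg t ht)) ?_ ht
    · have h2 : Real.exp (6 * (1 - t)) ≤ Real.exp 3 ^ 2 := by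
        rw [← Real.exp_nat_mul]
        exact Real.exp_le_exp.2 (by push_cast; linarith [ht.1])
      rw [← Real.sqrt_sq (Real.exp_pos 3).le, ← Real.sqrt_mul (hf.hess_nonneg hy w)]
      exact Real.sqrt_le_sqrt (h1.trans (mul_le_mul_of_nonneg_left h2 (hf.hess_nonneg hy w)))
    · intro t ht
      have h2 := (abs_le.1 (hf.abs_third_le (hseg t ht) u w)).1
      have h3 := hlt t ht
      have h4 := hf.hess_nonneg (hseg t ht) w
      have h5 : √(hess f (x + t • u) u u) * hess f (x + t • u) w w ≤
          1 * hess f (x + t • u) w w := by gcongr; linarith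
      linarith
  set W := √(hess f (x + (1 : ℝ) • u) w w) with hW
  have hW0 : 0 ≤ W := Real.sqrt_nonneg _
  have hthird : ∀ t ∈ Set.Icc (0 : ℝ) 1,
      |third f (x + t • u) u u w| ≤ 24 * Real.exp 3 * l ^ 2 * W := by
    intro t ht
    have hxt := hseg t ht
    have h1 := hf.abs_third_le hxt w u
    rw [hf.third_swap_left hxt, hf.third_swap_right hxt,
      ← Real.sq_sqrt (hf.hess_nonneg hxt u)] at h1
    calc |third f (x + t • u) u u w|
        ≤ 6 * √(hess f (x + t • u) w w) * √(hess f (x + t • u) u u) ^ 2 := h1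
      _ ≤ 6 * (W * Real.exp 3) * (2 * l) ^ 2 := by
        gcongr
        · exact hwt t ht
        · exact hlt t ht
      _ = 24 * Real.exp 3 * l ^ 2 * W := by ring
  -- Taylor for the slope in direction -w along the step: the constant and linear terms cancel by
  -- the Newton equation at x, while the Newton equation at y turns the left side into W².
  have hup := le_add_sq_of_second_deriv_le zero_le_one
    (fun t ht => hf.hasDerivAt_fderiv_line (-w) (hseg t ht))
    (fun t ht => hf.hasDerivAt_hess_line u (-w) (hseg t ht))
    (c := 24 * Real.exp 3 * l ^ 2 * W) fun t ht => by
      rw [map_neg]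
      exact (neg_le_abs _).trans (hthird t ht)
  have hWW : W ^ 2 = hess f (x + (1 : ℝ) • u) w w := Real.sq_sqrt (hf.hess_nonneg hy w)
  have hNx := isNewtonDirection_iff.1 hu (-w)
  have hNy := isNewtonDirection_iff.1 hw w
  simp only [map_neg, zero_smul, add_zero] at hup hNx
  rw [hNy] at hWW
  have hc : 0 ≤ 24 * Real.exp 3 * l ^ 2 := by positivity
  by_contra! hlt
  nlinarith [mul_nonneg hc hW0]

theorem le_add_sq_of_isNewtonDirection (hf : SelfConcordantOn D f) {x v z : E} (hx : x ∈ D)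
    (hz : z ∈ D) (hv : IsNewtonDirection f x v) (h : hess f x v v ≤ 1 / 4) :
    f x ≤ f z + hess f x v v := by
  set w := z - x with hw
  have hzw : x + (1 : ℝ) • w = z := by simp [hw]
  have hseg : ∀ t ∈ Set.Icc (0 : ℝ) 1, x + t • w ∈ D := fun t ht =>
    hf.add_smul_mem hx (by rwa [hzw]) ht
  set l := √(hess f x v v) with hl
  set r := √(hess f x w w) with hr
  have hl0 : 0 ≤ l := Real.sqrt_nonneg _
  have hr0 : 0 ≤ r := Real.sqrt_nonneg _
  have hl2 : l ^ 2 = hess f x v v := Real.sq_sqrt (hf.hess_nonneg hx v)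
  have hl1 : l ≤ 1 / 2 := by nlinarith
  have hpos : ∀ t ∈ Set.Icc (0 : ℝ) 1, 0 < 1 + r * t := fun t ht => by
    have := mul_nonneg hr0 ht.1
    linarith
  have hlin : ∀ t, HasDerivAt (fun t => 1 + r * t) r t := fun t => by
    simpa using ((hasDerivAt_id t).const_mul r).const_add 1
  have key := add_mul_le_of_second_deriv_nonneg
    (g := fun t => f (x + t • w) - (r * t - Real.log (1 + r * t)))
    (g' := fun t => fderiv ℝ f (x + t • w) w - (r - r / (1 + r * t)))
    (g'' := fun t => hess f (x + t • w) w w - r ^ 2 / (1 + r * t) ^ 2) zero_le_one ?_ ?_ ?_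
  · simp only [zero_smul, add_zero, mul_zero, Real.log_one, sub_zero, div_one, sub_self, mul_one,
      hzw] at key
    have h1 := isNewtonDirection_iff.1 hv w
    have h2 := (abs_le.1 (hf.abs_hess_le hx v w)).2
    rw [← hl, ← hr] at h2
    -- The lower bound r - lr - log(1+r) still depends on the distance r to z. This inequality
    -- replaces it by its minimum over r, l + log(1-l).
    have h3 := Real.log_le_sub_one_of_pos (mul_pos (by linarith : 0 < 1 + r)
      (by linarith : 0 < 1 - l))
    rw [Real.log_mul (by linarith) (by linarith)] at h3
    have h4 := neg_sub_log_one_sub_le_sq hl0 hl1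
    rw [← hl2]
    linarith
  · intro t ht
    refine (hf.hasDerivAt_comp_line (hseg t ht)).sub (HasDerivAt.sub ?_ ?_)
    · simpa using (hasDerivAt_id t).const_mul r
    · exact (hlin t).log (hpos t ht).ne'
  · intro t ht
    refine (hf.hasDerivAt_fderiv_line w (hseg t ht)).sub ?_
    refine ((hasDerivAt_const t r).sub ((hasDerivAt_const t r).div (hlin t)
      (hpos t ht).ne')).congr_deriv ?_
    ring
  · intro t ht
    have h1 := hf.abs_sqrt_hess_sub_le (x := x) (v := w) ht.1
      fun s hs => hseg s ⟨hs.1, hs.2.trans ht.2⟩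
    rw [← hr] at h1
    have hq := Real.sq_sqrt (hf.hess_nonneg (hseg t ht) w)
    have hq0 := Real.sqrt_nonneg (hess f (x + t • w) w w)
    rw [← hq, sub_nonneg, ← div_pow]
    refine pow_le_pow_left₀ (div_nonneg hr0 (hpos t ht).le) ?_ 2
    rw [div_le_iff₀ (hpos t ht)]
    have := (abs_le.1 h1).2
    linarith

end SelfConcordantOn

end NewtonAnalysis

/-! ### Iteration count for Newton's method. -/

section NewtonComplexity

/-- The factor in the quadratic convergence of Newton decrements. -/
def newtonQuadFactor : ℝ := 24 * Real.exp 3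

/-- A bound on the Newton decrement below which full Newton steps are taken and the decrements
converge quadratically. -/
def newtonRadius (a : ℝ) : ℝ := min ((1 - 2 * a) / 4) (1 / (2 * newtonQuadFactor))

theorem one_le_newtonQuadFactor : 1 ≤ newtonQuadFactor := by
  have := Real.add_one_le_exp 3
  unfold newtonQuadFactor
  linarith

theorem newtonRadius_pos {a : ℝ} (ha : a < 1 / 2) : 0 < newtonRadius a := by
  have := one_le_newtonQuadFactor
  exact lt_min (by linarith) (by positivity)

theorem newtonQuadFactor_mul_le {a l : ℝ} (hl : l ≤ newtonRadius a) :
    newtonQuadFactor * l ≤ 1 / 2 := by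
  have h0 := one_le_newtonQuadFactor
  have h := hl.trans (min_le_right _ _)
  rw [le_div_iff₀ (by linarith)] at h
  linarith

variable {E : Type*} [NormedAddCommGroup E] [NormedSpace ℝ E] {D : Set E} {f : E → ℝ}

theorem SelfConcordantOn.newtonReaches_mem_le (hf : SelfConcordantOn D f) {a b ε : ℝ}
    {x₀ y : E} {n : ℕ} (ha : 0 ≤ a) (hb : 0 ≤ b) (hx₀ : x₀ ∈ D)
    (h : NewtonReaches a b ε D f x₀ n y) : y ∈ D ∧ f y ≤ f x₀ := by
  induction h with
  | start => exact ⟨hx₀, le_rfl⟩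
  | step _ _ hs ih =>
    have := hf.newtonStep_mem_le ha hb ih.1 hs
    exact ⟨this.1, this.2.trans ih.2⟩

/-- After `n` iterations, of which `l` belong to the phase of quadratic convergence, the Newton
decrement is bounded in terms of `l`, and the other iterations have decreased the function by a
fixed amount each. -/
theorem SelfConcordantOn.newtonReaches_phases (hf : SelfConcordantOn D f) {a b ε : ℝ}
    {x₀ y : E} {n : ℕ} (ha₀ : 0 < a) (ha₁ : a < 1 / 2) (hb₀ : 0 < b) (hb₁ : b < 1)
    (hx₀ : x₀ ∈ D) (hcl : IsClosed {x | x ∈ D ∧ f x ≤ f x₀}) (hε : 0 < ε)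
    (h : NewtonReaches a b ε D f x₀ n y) :
    ∃ k l : ℕ, n = k + l ∧ k * (a * b * newtonRadius a ^ 2) ≤ f x₀ - f y ∧
      (l = 0 ∨ ((l : ℝ) ≤ Real.logb 2 (Real.logb 2 (1 / ε)) ∧
        ∀ v, IsNewtonDirection f y v → √(hess f y v v) ≤ newtonRadius a ∧
          newtonQuadFactor * √(hess f y v v) ≤ (1 / 2) ^ 2 ^ l)) := by
  have hη := newtonRadius_pos ha₁
  have hM := one_le_newtonQuadFactor
  have hηs : newtonRadius a ≤ (1 - 2 * a) / 4 := min_le_left _ _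
  -- With δ = 1 - 2a this reads 1 ≤ (1+δ)(1-δ/4)², true for 0 ≤ δ ≤ 1.
  have has : 1 ≤ 2 * (1 - a) * (1 - (1 - 2 * a) / 4) ^ 2 := by
    nlinarith [mul_nonneg ha₀.le (by linarith : 0 ≤ 1 - 2 * a),
      mul_nonneg (by linarith : 0 ≤ 1 - a) (sq_nonneg (1 - 2 * a))]
  induction h with
  | start => exact ⟨0, 0, rfl, by simp, Or.inl rfl⟩
  | @step n y z hr hns hst ih =>
    obtain ⟨k, l, rfl, hk, hl⟩ := ih
    obtain ⟨hy, hyx⟩ := hf.newtonReaches_mem_le ha₀.le hb₀.le hx₀ hr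
    obtain ⟨hz, hzy⟩ := hf.newtonStep_mem_le ha₀.le hb₀.le hy hst
    obtain ⟨v, hv, -⟩ := id hst
    set d := √(hess f y v v) with hd
    have hd0 : 0 ≤ d := Real.sqrt_nonneg _
    have hd2 : d ^ 2 = hess f y v v := Real.sq_sqrt (hf.hess_nonneg hy v)
    have quadratic : d ≤ newtonRadius a → newtonQuadFactor * d ≤ (1 / 2) ^ 2 ^ l →
        ∃ k' l' : ℕ, k + l + 1 = k' + l' ∧
          k' * (a * b * newtonRadius a ^ 2) ≤ f x₀ - f z ∧
          (l' = 0 ∨ ((l' : ℝ) ≤ Real.logb 2 (Real.logb 2 (1 / ε)) ∧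
            ∀ v, IsNewtonDirection f z v → √(hess f z v v) ≤ newtonRadius a ∧
              newtonQuadFactor * √(hess f z v v) ≤ (1 / 2) ^ 2 ^ l')) := by
      intro hdη hdl
      refine ⟨k, l + 1, by ring, by linarith, Or.inr ⟨?_, fun w hw => ?_⟩⟩
      -- As d is so small that d ≤ 1/2 holds, the test can only have failed at y through λ² > ε.
      -- Since Mλ ≤ 2^(-2^l) there, this bounds the count l + 1 including the present step.
      · have h1 : ε < d ^ 2 := by
          by_contra! hle
          refine hns (newtonStops_iff.2 ⟨v, hv, by rwa [← hd2], ?_⟩)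
          rw [← hd2]
          nlinarith
        have h2 : ε < (1 / 2 : ℝ) ^ 2 ^ (l + 1) := by
          calc ε < d ^ 2 := h1
            _ ≤ (newtonQuadFactor * d) ^ 2 := by
              gcongr
              exact le_mul_of_one_le_left hd0 hM
            _ ≤ ((1 / 2 : ℝ) ^ 2 ^ l) ^ 2 := by gcongr
            _ = (1 / 2 : ℝ) ^ 2 ^ (l + 1) := by rw [← pow_mul, ← pow_succ]
        have h3 : (2 : ℝ) ^ (2 ^ (l + 1) : ℕ) ≤ 1 / ε := by
          rw [le_div_iff₀ hε]
          rw [one_div, inv_pow] at h2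
          have hp : (0 : ℝ) < 2 ^ 2 ^ (l + 1) := by positivity
          calc (2 : ℝ) ^ 2 ^ (l + 1) * ε ≤ 2 ^ 2 ^ (l + 1) * (2 ^ 2 ^ (l + 1))⁻¹ := by gcongr
            _ = 1 := mul_inv_cancel₀ hp.ne'
        have h4 : (2 : ℝ) ^ (l + 1) ≤ Real.logb 2 (1 / ε) := by
          rw [Real.le_logb_iff_rpow_le one_lt_two (by positivity)]
          refine le_trans (le_of_eq ?_) h3
          rw [← Real.rpow_natCast 2 (2 ^ (l + 1))]
          push_cast
          rfl
        rw [Real.le_logb_iff_rpow_le one_lt_two (lt_of_lt_of_le (by positivity) h4),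
          Real.rpow_natCast]
        exact h4
      · have h1 := hf.newtonStep_quadratic ha₀.le (by linarith) has hcl hy hyx hv
          (hdη.trans hηs) hst hw
        rw [← newtonQuadFactor, ← hd] at h1
        have h2 := newtonQuadFactor_mul_le hdη
        constructor
        -- Md ≤ 1/2 gives a new decrement of at most d/2, so the quadratic phase is never left.
        · nlinarith
        · calc newtonQuadFactor * √(hess f z w w)
              ≤ newtonQuadFactor * (newtonQuadFactor * d ^ 2) := by gcongr
            _ = (newtonQuadFactor * d) ^ 2 := by ring
            _ ≤ ((1 / 2 : ℝ) ^ 2 ^ l) ^ 2 := by gcongr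
            _ = (1 / 2 : ℝ) ^ 2 ^ (l + 1) := by rw [← pow_mul, ← pow_succ]
    rcases hl with rfl | ⟨-, hl⟩
    · rcases le_total d (newtonRadius a) with hdη | hdη
      · exact quadratic hdη (by simpa using newtonQuadFactor_mul_le hdη)
      · refine ⟨k + 1, 0, rfl, ?_, Or.inl rfl⟩
        have := hf.newtonStep_damped ha₀.le hb₀ hb₁ hη.le hηs (by linarith) has hcl hy hyx hv
          hdη hst
        push_cast
        linarith
    · exact quadratic (hl v hv).1 (hl v hv).2

/-- The number of Newton iterations per unit of decrease. -/
def newtonConstant (a b : ℝ) : ℝ := (a * b * newtonRadius a ^ 2)⁻¹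

theorem newtonConstant_pos {a b : ℝ} (ha₀ : 0 < a) (ha₁ : a < 1 / 2) (hb₀ : 0 < b) :
    0 < newtonConstant a b := by
  have := newtonRadius_pos ha₁
  unfold newtonConstant
  positivity

theorem SelfConcordantOn.newton_complexity [FiniteDimensional ℝ E] (hf : SelfConcordantOn D f)
    {a b ε : ℝ} {x₀ y : E} {n : ℕ} (ha₀ : 0 < a) (ha₁ : a < 1 / 2) (hb₀ : 0 < b) (hb₁ : b < 1)
    (hx₀ : x₀ ∈ D) (hcl : IsClosed {x | x ∈ D ∧ f x ≤ f x₀}) (hbdd : BddBelow (f '' D))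
    (hε₀ : 0 < ε) (hε₁ : ε ≤ 1 / 2) (h : NewtonReaches a b ε D f x₀ n y) :
    (n : ℝ) ≤ newtonConstant a b * (f x₀ - sInf (f '' D)) + Real.logb 2 (Real.logb 2 (1 / ε)) ∧
      y ∈ D ∧ (NewtonStops f ε y → f y - sInf (f '' D) ≤ ε) ∧
      (¬ NewtonStops f ε y → ∃ z, NewtonStep a b D f y z) := by
  obtain ⟨hy, hyx⟩ := hf.newtonReaches_mem_le ha₀.le hb₀.le hx₀ h
  refine ⟨?_, hy, ?_, fun _ => ?_⟩
  · obtain ⟨k, l, rfl, hk, hl⟩ := hf.newtonReaches_phases ha₀ ha₁ hb₀ hb₁ hx₀ hcl hε₀ h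
    have hC := newtonConstant_pos ha₀ ha₁ hb₀
    have hll : (l : ℝ) ≤ Real.logb 2 (Real.logb 2 (1 / ε)) := by
      rcases hl with rfl | hl
      -- With no quadratic step, the iterated logarithm must still be nonnegative; this is where ε ≤
      -- 1/2 enters.
      · have h2 : (2 : ℝ) ≤ 1 / ε := by
          rw [le_div_iff₀ hε₀]
          linarith
        have h1 : (1 : ℝ) ≤ Real.logb 2 (1 / ε) := by
          rw [Real.le_logb_iff_rpow_le one_lt_two (by positivity), Real.rpow_one]
          exact h2
        simpa using Real.logb_nonneg one_lt_two h1
      · exact hl.1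
    have hinf : sInf (f '' D) ≤ f y := csInf_le hbdd ⟨y, hy, rfl⟩
    have hkC : (k : ℝ) ≤ newtonConstant a b * (f x₀ - f y) := by
      rw [newtonConstant] at hC ⊢
      rw [inv_mul_eq_div, le_div_iff₀ (inv_pos.1 hC)]
      exact hk
    push_cast
    nlinarith
  · intro hs
    obtain ⟨v, hv, h1, h2⟩ := newtonStops_iff.1 hs
    have : f y - ε ≤ sInf (f '' D) := by
      refine le_csInf ⟨_, y, hy, rfl⟩ ?_
      rintro _ ⟨z, hz, rfl⟩
      linarith [hf.le_add_sq_of_isNewtonDirection hy hz hv h2]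
    linarith
  · have hs : 0 < (1 - 2 * a) / 4 := by linarith
    refine hf.exists_newtonStep ha₀.le hb₀ hb₁ hs (by linarith) ?_ hcl hbdd hy hyx
    nlinarith [mul_nonneg ha₀.le (by linarith : 0 ≤ 1 - 2 * a),
      mul_nonneg (by linarith : 0 ≤ 1 - a) (sq_nonneg (1 - 2 * a))]

theorem SelfConcordantOn.exists_newton_output [FiniteDimensional ℝ E]
    (hf : SelfConcordantOn D f) {a b ε : ℝ} {x₀ : E} (ha₀ : 0 < a) (ha₁ : a < 1 / 2)
    (hb₀ : 0 < b) (hb₁ : b < 1) (hx₀ : x₀ ∈ D) (hcl : IsClosed {x | x ∈ D ∧ f x ≤ f x₀})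
    (hbdd : BddBelow (f '' D)) (hε₀ : 0 < ε) (hε₁ : ε ≤ 1 / 2) :
    ∃ n y, NewtonReaches a b ε D f x₀ n y ∧ NewtonStops f ε y := by
  by_contra! hcon
  have hall : ∀ n : ℕ, ∃ y, NewtonReaches a b ε D f x₀ n y := by
    intro n
    induction n with
    | zero => exact ⟨x₀, .start⟩
    | succ n ih =>
      obtain ⟨y, hy⟩ := ih
      obtain ⟨z, hz⟩ := (hf.newton_complexity ha₀ ha₁ hb₀ hb₁ hx₀ hcl hbdd hε₀ hε₁ hy).2.2.2
        (hcon n y hy)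
      exact ⟨z, .step hy (hcon n y hy) hz⟩
  obtain ⟨n, hn⟩ := exists_nat_gt (newtonConstant a b * (f x₀ - sInf (f '' D)) +
    Real.logb 2 (Real.logb 2 (1 / ε)))
  obtain ⟨y, hy⟩ := hall n
  exact hn.not_ge (hf.newton_complexity ha₀ ha₁ hb₀ hb₁ hx₀ hcl hbdd hε₀ hε₁ hy).1

end NewtonComplexity

/-! ### Self-concordance of logarithmic barriers. -/

section LogBarrier

variable {E ι : Type*} [NormedAddCommGroup E] [NormedSpace ℝ E] [Fintype ι]

/-- The set on which the linear functionals `A i` are positive. -/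
def barrierDomain (A : ι → E →L[ℝ] ℝ) : Set E := {x | ∀ i, 0 < A i x}

/-- A linear function plus a logarithmic barrier. -/
def logBarrier (A : ι → E →L[ℝ] ℝ) (B : E →L[ℝ] ℝ) (x : E) : ℝ := B x - ∑ i, Real.log (A i x)

variable (A : ι → E →L[ℝ] ℝ) (B : E →L[ℝ] ℝ)

theorem isOpen_barrierDomain : IsOpen (barrierDomain A) := by
  have : barrierDomain A = ⋂ i, {x | 0 < A i x} := by
    ext x; simp [barrierDomain]
  rw [this]
  exact isOpen_iInter_of_finite fun i => isOpen_lt continuous_const (A i).continuous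

variable {A}

theorem hasFDerivAt_logBarrier {x : E} (hx : x ∈ barrierDomain A) :
    HasFDerivAt (logBarrier A B) (B - ∑ i, (A i x)⁻¹ • A i) x :=
  B.hasFDerivAt.sub (HasFDerivAt.fun_sum fun i _ => (A i).hasFDerivAt.log (hx i).ne')

theorem fderiv_logBarrier_eventuallyEq {x : E} (hx : x ∈ barrierDomain A) :
    fderiv ℝ (logBarrier A B) =ᶠ[nhds x] fun y => B - ∑ i, (A i y)⁻¹ • A i := by
  filter_upwards [(isOpen_barrierDomain A).mem_nhds hx] with y hy
    using (hasFDerivAt_logBarrier B hy).fderiv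

omit [Fintype ι] in
theorem hasFDerivAt_inv_apply {x : E} (hx : x ∈ barrierDomain A) (i : ι) :
    HasFDerivAt (fun y => (A i y)⁻¹) (-((A i x)⁻¹ ^ 2) • A i) x := by
  have := (hasDerivAt_inv (hx i).ne').comp_hasFDerivAt x (A i).hasFDerivAt
  rw [inv_pow]
  exact this

theorem hess_logBarrier {x : E} (hx : x ∈ barrierDomain A) :
    hess (logBarrier A B) x = ∑ i, (A i x)⁻¹ ^ 2 • (A i).smulRight (A i) := by
  rw [hess, (fderiv_logBarrier_eventuallyEq B hx).fderiv_eq]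
  have h := (hasFDerivAt_const B x).sub
    (HasFDerivAt.fun_sum fun i (_ : i ∈ Finset.univ) =>
      (hasFDerivAt_inv_apply hx i).smul_const (A i))
  refine h.fderiv.trans ?_
  ext v w
  simp [mul_assoc]

set_option maxSynthPendingDepth 3 in
theorem third_logBarrier_apply {x : E} (hx : x ∈ barrierDomain A) (v : E) :
    third (logBarrier A B) x v v v = -2 * ∑ i, ((A i x)⁻¹ * A i v) ^ 3 := by
  have hev : hess (logBarrier A B) =ᶠ[nhds x]
      fun y => ∑ i, (A i y)⁻¹ ^ 2 • (A i).smulRight (A i) := by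
    filter_upwards [(isOpen_barrierDomain A).mem_nhds hx] with y hy using hess_logBarrier B hy
  have h : HasFDerivAt (fun y => ∑ i, (A i y)⁻¹ ^ 2 • (A i).smulRight (A i)) _ x :=
    HasFDerivAt.fun_sum fun i (_ : i ∈ Finset.univ) =>
      ((hasFDerivAt_inv_apply hx i).pow 2).smul_const ((A i).smulRight (A i))
  rw [show third (logBarrier A B) x = _ from hev.fderiv_eq.trans h.fderiv]
  simp only [sum_apply, ContinuousLinearMap.smulRight_apply, smul_apply, smul_eq_mul,
    Finset.mul_sum]
  refine Finset.sum_congr rfl fun i _ => ?_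
  simp
  ring

/-- Each |yᵢ| is at most the Euclidean norm. With yᵢ = Aᵢv/Aᵢx the Hessian of the barrier is ∑ yᵢ²
and its third derivative -2∑ yᵢ³, so this is the self-concordance inequality. -/
theorem abs_sum_cube_le (y : ι → ℝ) : |∑ i, y i ^ 3| ≤ (∑ i, y i ^ 2) ^ (3 / 2 : ℝ) := by
  set S := ∑ i, y i ^ 2 with hS
  have hS0 : 0 ≤ S := Finset.sum_nonneg fun i _ => sq_nonneg _
  have hy : ∀ i, |y i| ≤ √S := fun i =>
    Real.abs_le_sqrt (Finset.single_le_sum (f := fun i => y i ^ 2)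
      (fun i _ => sq_nonneg _) (Finset.mem_univ i))
  calc |∑ i, y i ^ 3| ≤ ∑ i, |y i ^ 3| := Finset.abs_sum_le_sum_abs _ _
    _ ≤ ∑ i, √S * y i ^ 2 := by
      refine Finset.sum_le_sum fun i _ => ?_
      rw [abs_pow, pow_succ', sq_abs]
      gcongr
      exact hy i
    _ = √S * S := by rw [← Finset.mul_sum]
    _ = √S ^ 3 := by rw [pow_succ', Real.sq_sqrt hS0]
    _ = S ^ (3 / 2 : ℝ) := by
      rw [Real.sqrt_eq_rpow, ← Real.rpow_natCast, ← Real.rpow_mul hS0]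
      norm_num

variable (A)

theorem convexOn_logBarrier : ConvexOn ℝ (barrierDomain A) (logBarrier A B) := by
  have hlin : ∀ (L : E →L[ℝ] ℝ) (x y : E) (p q : ℝ), L (p • x + q • y) = p * L x + q * L y :=
    fun L x y p q => by simp
  refine ⟨fun x hx y hy p q hp hq hpq i => ?_, fun x hx y hy p q hp hq hpq => ?_⟩
  · rw [hlin]
    exact (convex_Ioi (0 : ℝ)) (hx i) (hy i) hp hq hpq
  · have : ∑ i, (p * Real.log (A i x) + q * Real.log (A i y)) ≤
        ∑ i, Real.log (A i (p • x + q • y)) := by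
      refine Finset.sum_le_sum fun i _ => ?_
      rw [hlin]
      exact strictConcaveOn_log_Ioi.concaveOn.2 (hx i) (hy i) hp hq hpq
    rw [Finset.sum_add_distrib, ← Finset.mul_sum, ← Finset.mul_sum] at this
    simp only [logBarrier, hlin, smul_eq_mul] at this ⊢
    linarith

theorem selfConcordantOn_logBarrier :
    SelfConcordantOn (barrierDomain A) (logBarrier A B) where
  isOpen := isOpen_barrierDomain A
  convexOn := convexOn_logBarrier A B
  contDiffOn := by
    refine B.contDiff.contDiffOn.sub (ContDiffOn.sum fun i _ => ?_)
    exact (A i).contDiff.contDiffOn.log fun x hx => (hx i).ne'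
  third_le := by
    intro x hx v
    rw [iteratedFDeriv_three_eq_third, iteratedFDeriv_two_eq_hess,
      third_logBarrier_apply B hx, hess_logBarrier B hx, abs_mul]
    have := abs_sum_cube_le fun i => (A i x)⁻¹ * A i v
    have heq : (∑ i, (A i x)⁻¹ ^ 2 • (A i).smulRight (A i)) v v =
        ∑ i, ((A i x)⁻¹ * A i v) ^ 2 := by
      simp only [sum_apply, ContinuousLinearMap.smulRight_apply, smul_apply, smul_eq_mul]
      exact Finset.sum_congr rfl fun i _ => by ring
    rw [heq]
    norm_num
    exact this

theorem isClosed_sublevel_logBarrier (c : ℝ) :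
    IsClosed {x | x ∈ barrierDomain A ∧ logBarrier A B x ≤ c} := by
  -- Exponentiating removes the logarithms and leaves closed conditions: a positive lower bound on
  -- the product of nonnegative factors already forces each factor to be positive.
  have hset : {x | x ∈ barrierDomain A ∧ logBarrier A B x ≤ c} =
      (⋂ i, {x | 0 ≤ A i x}) ∩ {x | Real.exp (B x - c) ≤ ∏ i, A i x} := by
    ext x
    simp only [Set.mem_ofPred_eq, Set.mem_inter_iff, Set.mem_iInter]
    have hlog : x ∈ barrierDomain A →
        (logBarrier A B x ≤ c ↔ Real.exp (B x - c) ≤ ∏ i, A i x) := by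
      intro hx
      rw [← Real.le_log_iff_exp_le (Finset.prod_pos fun i _ => hx i),
        Real.log_prod fun i _ => (hx i).ne', logBarrier]
      constructor <;> intro h <;> linarith
    constructor
    · rintro ⟨hx, h⟩
      exact ⟨fun i => (hx i).le, (hlog hx).1 h⟩
    · rintro ⟨hx, h⟩
      have hD : x ∈ barrierDomain A := by
        intro i
        refine (hx i).lt_of_ne fun h0 => ?_
        rw [Finset.prod_eq_zero (Finset.mem_univ i) h0.symm] at h
        exact (Real.exp_pos _).not_ge h
      exact ⟨hD, (hlog hD).2 h⟩
  rw [hset]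
  refine (isClosed_iInter fun i => isClosed_le continuous_const (A i).continuous).inter
    (isClosed_le ?_ ?_)
  · fun_prop
  · fun_prop

end LogBarrier

/-! ### The relaxed log-likelihood and the stages of MEMIP. -/

section Memip

/-- The Euclidean pairing with a fixed vector of coefficients as a continuous linear functional. -/
def hawkesDotCLM {d k : ℕ} (c : HawkesParam d k) : HawkesParam d k →L[ℝ] ℝ :=
  LinearMap.toContinuousLinearMap
    { toFun := hawkesDot c
      map_add' := fun X Y => by
        simp only [hawkesDot, Pi.add_apply, mul_add, Finset.sum_add_distrib]
      map_smul' := fun r X => by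
        simp only [hawkesDot, Pi.smul_apply, smul_eq_mul, RingHom.id_apply, Finset.mul_sum,
          mul_left_comm] }

variable {d m : ℕ} (α : ℝ) (H : Fin m → HawkesRealization d) (k : ℕ)

theorem relaxedDomain_eq_barrierDomain : relaxedDomain α H k =
    barrierDomain fun e : Σ r, Fin (H r).n => hawkesDotCLM (hawkesA α (H e.1) e.2 k) := by
  ext X
  exact ⟨fun h e => h e.1 e.2, fun h r i => h ⟨r, i⟩⟩

theorem neg_relaxedLogLik_eq_logBarrier : (fun X => -relaxedLogLik α H k X) =
    logBarrier (fun e : Σ r, Fin (H r).n => hawkesDotCLM (hawkesA α (H e.1) e.2 k))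
      (hawkesDotCLM (hawkesB α H k)) := by
  funext X
  rw [logBarrier, Fintype.sum_sigma, relaxedLogLik, neg_sub]
  rfl

theorem selfConcordantOn_neg_relaxedLogLik :
    SelfConcordantOn (relaxedDomain α H k) fun X => -relaxedLogLik α H k X := by
  rw [relaxedDomain_eq_barrierDomain, neg_relaxedLogLik_eq_logBarrier]
  exact selfConcordantOn_logBarrier _ _

theorem isClosed_sublevel_neg_relaxedLogLik (c : ℝ) :
    IsClosed {X | X ∈ relaxedDomain α H k ∧ -relaxedLogLik α H k X ≤ c} := by
  have h := isClosed_sublevel_logBarrier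
    (fun e : Σ r, Fin (H r).n => hawkesDotCLM (hawkesA α (H e.1) e.2 k))
    (hawkesDotCLM (hawkesB α H k)) c
  rwa [← relaxedDomain_eq_barrierDomain, ← neg_relaxedLogLik_eq_logBarrier] at h

theorem image_neg_relaxedLogLik : (fun X => -relaxedLogLik α H k X) '' relaxedDomain α H k =
    -relaxedValues α H k := by
  rw [relaxedValues, ← Set.image_neg_eq_neg, Set.image_image]

variable {k}

theorem hawkesDot_warmStart (c : HawkesParam d (k + 1)) (X : HawkesParam d k) :
    hawkesDot c (warmStart X) = hawkesDot (fun u v j => c u v j.castSucc) X := by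
  simp only [hawkesDot, Fin.sum_univ_castSucc]
  simp [warmStart]

theorem hawkesDot_hawkesA_warmStart (h : HawkesRealization d) (i : Fin h.n)
    (X : HawkesParam d k) :
    hawkesDot (hawkesA α h i (k + 1)) (warmStart X) = hawkesDot (hawkesA α h i k) X :=
  hawkesDot_warmStart _ X

theorem warmStart_mem_relaxedDomain {X : HawkesParam d k} :
    warmStart X ∈ relaxedDomain α H (k + 1) ↔ X ∈ relaxedDomain α H k :=
  forall₂_congr fun r i => by rw [hawkesDot_hawkesA_warmStart]

theorem relaxedLogLik_warmStart (X : HawkesParam d k) :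
    relaxedLogLik α H (k + 1) (warmStart X) = relaxedLogLik α H k X := by
  simp only [relaxedLogLik, hawkesDot_hawkesA_warmStart]
  rw [show hawkesDot (hawkesB α H (k + 1)) (warmStart X) = hawkesDot (hawkesB α H k) X from
    hawkesDot_warmStart _ X]

/-- Padding with zeros embeds each stage in the next, so boundedness at stage K passes down to all
earlier stages and the suprema increase. -/
theorem relaxedValues_mono : Monotone (relaxedValues α H) := by
  refine monotone_nat_of_le_succ fun k => ?_
  rintro _ ⟨X, hX, rfl⟩
  exact ⟨warmStart X, (warmStart_mem_relaxedDomain α H).2 hX, relaxedLogLik_warmStart α H X⟩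

variable {α H} {a b ε : ℝ}

theorem IsNewtonArgMax.relaxedLogLik_bounds (ha₀ : 0 < a) (ha₁ : a < 1 / 2) (hb₀ : 0 < b)
    (hb₁ : b < 1) (hε₀ : 0 < ε) (hε₁ : ε ≤ 1 / 2) {W X : HawkesParam d k} {n : ℕ}
    (hW : W ∈ relaxedDomain α H k) (hbdd : BddAbove (relaxedValues α H k))
    (h : IsNewtonArgMax a b ε (relaxedDomain α H k) (relaxedLogLik α H k) W n X) :
    X ∈ relaxedDomain α H k ∧
      |relaxedLogLik α H k X - sSup (relaxedValues α H k)| ≤ ε ∧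
      (n : ℝ) ≤ newtonConstant a b * (sSup (relaxedValues α H k) - relaxedLogLik α H k W) +
        Real.logb 2 (Real.logb 2 (1 / ε)) := by
  have hmain := (selfConcordantOn_neg_relaxedLogLik α H k).newton_complexity ha₀ ha₁ hb₀ hb₁ hW
    (isClosed_sublevel_neg_relaxedLogLik α H k _)
    (by rw [image_neg_relaxedLogLik]; exact hbdd.neg) hε₀ hε₁ h.1
  rw [image_neg_relaxedLogLik, Real.sInf_neg] at hmain
  obtain ⟨hn, hX, hgap, -⟩ := hmain
  have hgap := hgap h.2
  have hsup := le_csSup hbdd ⟨X, hX, rfl⟩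
  refine ⟨hX, ?_, ?_⟩
  · rw [abs_le]
    constructor <;> linarith
  · rwa [neg_sub_neg] at hn

theorem exists_isNewtonArgMax_relaxedLogLik (ha₀ : 0 < a) (ha₁ : a < 1 / 2) (hb₀ : 0 < b)
    (hb₁ : b < 1) (hε₀ : 0 < ε) (hε₁ : ε ≤ 1 / 2) {W : HawkesParam d k}
    (hW : W ∈ relaxedDomain α H k) (hbdd : BddAbove (relaxedValues α H k)) :
    ∃ n X, IsNewtonArgMax a b ε (relaxedDomain α H k) (relaxedLogLik α H k) W n X :=
  (selfConcordantOn_neg_relaxedLogLik α H k).exists_newton_output ha₀ ha₁ hb₀ hb₁ hW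
    (isClosed_sublevel_neg_relaxedLogLik α H k _)
    (by rw [image_neg_relaxedLogLik]; exact hbdd.neg) hε₀ hε₁

theorem IsMemipRun.of_succ {K : ℕ} {W₁ : HawkesParam d 1} {n : ℕ → ℕ}
    {X : (k : ℕ) → HawkesParam d k} (h : IsMemipRun a b ε α H (K + 1) W₁ n X) :
    IsMemipRun a b ε α H K W₁ n X :=
  ⟨h.first, fun k hk hkK => h.next k hk (hkK.trans K.lt_succ_self)⟩

theorem IsMemipRun.bounds (ha₀ : 0 < a) (ha₁ : a < 1 / 2) (hb₀ : 0 < b)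
    (hb₁ : b < 1) (hε₀ : 0 < ε) (hε₁ : ε ≤ 1 / 2) {K : ℕ} (hK : 1 ≤ K) {W₁ : HawkesParam d 1}
    {n : ℕ → ℕ} {X : (k : ℕ) → HawkesParam d k} (hW : W₁ ∈ relaxedDomain α H 1)
    (hbdd : BddAbove (relaxedValues α H K)) (h : IsMemipRun a b ε α H K W₁ n X) :
    (∀ k, 1 ≤ k → k ≤ K → X k ∈ relaxedDomain α H k ∧ BddAbove (relaxedValues α H k) ∧
      |relaxedLogLik α H k (X k) - sSup (relaxedValues α H k)| ≤ ε) ∧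
    ∑ k ∈ Finset.Icc 1 K, (n k : ℝ) ≤
      newtonConstant a b * (sSup (relaxedValues α H K) - relaxedLogLik α H 1 W₁) +
        K * (Real.logb 2 (Real.logb 2 (1 / ε)) + newtonConstant a b * ε) := by
  have hC := newtonConstant_pos ha₀ ha₁ hb₀
  induction K, hK using Nat.le_induction with
  | base =>
    obtain ⟨h1, h2, h3⟩ := h.first.relaxedLogLik_bounds ha₀ ha₁ hb₀ hb₁ hε₀ hε₁ hW hbdd
    refine ⟨fun k hk hk1 => ?_, ?_⟩
    · obtain rfl : k = 1 := le_antisymm hk1 hk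
      exact ⟨h1, hbdd, h2⟩
    · simp only [Finset.Icc_self, Finset.sum_singleton, Nat.cast_one, one_mul]
      nlinarith [mul_pos hC hε₀]
  | succ K hK ih =>
    have hbK := hbdd.mono (relaxedValues_mono α H K.le_succ)
    obtain ⟨ih1, ih2⟩ := ih hbK h.of_succ
    obtain ⟨hXK, -, hgap⟩ := ih1 K hK le_rfl
    obtain ⟨h1, h2, h3⟩ := (h.next K hK K.lt_succ_self).relaxedLogLik_bounds ha₀ ha₁ hb₀ hb₁
      hε₀ hε₁ ((warmStart_mem_relaxedDomain α H).2 hXK) hbdd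
    refine ⟨fun k hk hkK => ?_, ?_⟩
    · rcases hkK.lt_or_eq with hlt | rfl
      · exact ih1 k hk (Nat.lt_succ_iff.1 hlt)
      · exact ⟨h1, hbdd, h2⟩
    · rw [Finset.sum_Icc_succ_top (by omega)]
      rw [relaxedLogLik_warmStart] at h3
      -- The telescoping step: the new stage starts no more than ε below the supremum of stage K,
      -- which cancels against the bound for the first K stages.
      have h4 := mul_le_mul_of_nonneg_left (abs_le.1 hgap).1 hC.le
      push_cast
      linarith

theorem exists_isMemipRun (ha₀ : 0 < a) (ha₁ : a < 1 / 2) (hb₀ : 0 < b)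
    (hb₁ : b < 1) (hε₀ : 0 < ε) (hε₁ : ε ≤ 1 / 2) {K : ℕ} (hK : 1 ≤ K) {W₁ : HawkesParam d 1}
    (hW : W₁ ∈ relaxedDomain α H 1) (hbdd : BddAbove (relaxedValues α H K)) :
    ∃ (n : ℕ → ℕ) (X : (k : ℕ) → HawkesParam d k), IsMemipRun a b ε α H K W₁ n X := by
  classical
  induction K, hK using Nat.le_induction with
  | base =>
    obtain ⟨n, X, h⟩ := exists_isNewtonArgMax_relaxedLogLik ha₀ ha₁ hb₀ hb₁ hε₀ hε₁ hW hbdd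
    -- Entries other than stage 1 are arbitrary here, since a one-stage run does not constrain them.
    refine ⟨fun _ => n, Function.update (fun _ => 0) 1 X, ?_, fun k hk hk1 => by omega⟩
    rwa [Function.update_self]
  | succ K hK ih =>
    have hbK := hbdd.mono (relaxedValues_mono α H K.le_succ)
    obtain ⟨n, X, h⟩ := ih hbK
    have hXK := ((h.bounds ha₀ ha₁ hb₀ hb₁ hε₀ hε₁ hK hW hbK).1 K hK le_rfl).1
    obtain ⟨n', X', h'⟩ := exists_isNewtonArgMax_relaxedLogLik ha₀ ha₁ hb₀ hb₁ hε₀ hε₁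
      ((warmStart_mem_relaxedDomain α H).2 hXK) hbdd
    have hne : ∀ k ≤ K, k ≠ K + 1 := fun k hk => by omega
    refine ⟨Function.update n (K + 1) n', Function.update X (K + 1) X', ?_, fun k hk hkK => ?_⟩
    · rw [Function.update_of_ne (hne 1 hK), Function.update_of_ne (hne 1 hK)]
      exact h.first
    · rw [Function.update_of_ne (hne k (Nat.lt_succ_iff.1 hkK))]
      rcases (Nat.lt_succ_iff.1 hkK).lt_or_eq with hlt | rfl
      · rw [Function.update_of_ne (hne _ hlt), Function.update_of_ne (hne _ hlt)]
        exact h.next k hk hlt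
      · rw [Function.update_self, Function.update_self]
        exact h'

end Memip

end

theorem proposition4 (a b : ℝ) (ha₀ : 0 < a) (ha₁ : a < 1 / 2) (hb₀ : 0 < b) (hb₁ : b < 1) :
    ∃ C : ℝ, 0 < C ∧
      -- Newton's method on a self-concordant function
      (∀ (N : ℕ) (D : Set (EuclideanSpace ℝ (Fin N))) (f : EuclideanSpace ℝ (Fin N) → ℝ)
        (x₀ : EuclideanSpace ℝ (Fin N)) (ε : ℝ),
        SelfConcordantOn D f → x₀ ∈ D → IsClosed {x | x ∈ D ∧ f x ≤ f x₀} →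
        BddBelow (f '' D) → 0 < ε → ε ≤ 1 / 2 →
        ∀ (n : ℕ) (y : EuclideanSpace ℝ (Fin N)), NewtonReaches a b ε D f x₀ n y →
          (n : ℝ) ≤ C * (f x₀ - sInf (f '' D)) + Real.logb 2 (Real.logb 2 (1 / ε)) ∧
          y ∈ D ∧
          (NewtonStops f ε y → f y - sInf (f '' D) ≤ ε) ∧
          (¬ NewtonStops f ε y → ∃ z, NewtonStep a b D f y z)) ∧
      -- MEMIP
      (∀ (d m K : ℕ) (H : Fin m → HawkesRealization d) (α ε : ℝ) (W₁ : HawkesParam d 1),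
        1 ≤ K → 0 < α → 0 < ε → ε ≤ 1 / 2 →
        W₁ ∈ relaxedDomain α H 1 → BddAbove (relaxedValues α H K) →
        (∃ (n : ℕ → ℕ) (X : (k : ℕ) → HawkesParam d k), IsMemipRun a b ε α H K W₁ n X) ∧
        ∀ (n : ℕ → ℕ) (X : (k : ℕ) → HawkesParam d k), IsMemipRun a b ε α H K W₁ n X →
          (∀ k, 1 ≤ k → k ≤ K →
            X k ∈ relaxedDomain α H k ∧ BddAbove (relaxedValues α H k) ∧
            |relaxedLogLik α H k (X k) - sSup (relaxedValues α H k)| ≤ ε) ∧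
          ∑ k ∈ Finset.Icc 1 K, (n k : ℝ) ≤
            C * (sSup (relaxedValues α H K) - relaxedLogLik α H 1 W₁) +
              K * (Real.logb 2 (Real.logb 2 (1 / ε)) + C * ε)) := by
  refine ⟨newtonConstant a b, newtonConstant_pos ha₀ ha₁ hb₀, ?_, ?_⟩
  · intro N D f x₀ ε hf hx₀ hcl hbdd hε₀ hε₁ n y h
    exact hf.newton_complexity ha₀ ha₁ hb₀ hb₁ hx₀ hcl hbdd hε₀ hε₁ h
  · intro d m K H α ε W₁ hK _ hε₀ hε₁ hW hbdd
    exact ⟨exists_isMemipRun ha₀ ha₁ hb₀ hb₁ hε₀ hε₁ hK hW hbdd, fun n X h =>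
      h.bounds ha₀ ha₁ hb₀ hb₁ hε₀ hε₁ hK hW hbdd⟩
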